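/- **Setting.** MLO is the monadic second-order logic of order: formulas are built from the atomic formulas $X(t)$ and $t_1<t_2$ by Boolean connectives (including the constant false, the empty disjunction) and by quantification over elements and over subsets; its structures are nonempty. For an ordinal $\alpha>0$ and an MLO formula $\varphi(X_1,X_2)$ whose only free variables are the set variables $X_1,X_2$, the game $\mathcal G^\alpha_\varphi$ has $\alpha$ rounds; in round $\gamma<\alpha$ first Player I decides whether $\gamma\in P$, then Player II decides whether $\gamma\in Q$; Player I wins iff $(\alpha,<)\models\varphi(P,Q)$. A winning strategy of Player I is a map $f:\mathcal P(\alpha)\to\mathcal P(\alpha)$ such that $f(Q)\cap[0,\gamma]$ depends only on $Q\cap[0,\gamma)$ for all $\gamma<\alpha$, and $(\alpha,<)\models\varphi(f(Q),Q)$ for all $Q\subseteq\alpha$. A winning strategy of Player II is a map $f$ such that $f(P)\cap[0,\gamma]$ depends only on $P\cap[0,\gamma]$ for all $\gamma<\alpha$, and $(\alpha,<)\models\neg\varphi(P,f(P))$ for all $P\subseteq\alpha$. The ordinal $\alpha>0$ is *determinate* if for every $\varphi(X_1,X_2)$ one of the players has a winning strategy in $\mathcal G^\alpha_\varphi$. Let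 $Char^n_2$ be the finite set of characteristic (Hintikka) formulas of quantifier depth $n$ in the free variables $X_1,X_2$, constructed in the usual way, so that every structure $(A,<,P,Q)$ satisfies exactly one of them, its $n$-type. For $\tau,\tau'\in Char^n_2$ let $\tau+\tau'\in Char^n_2$ be a formula that is the $n$-type of the ordered sum $M+M'$ for all chains (linear orders with two subsets) $M$, $M'$ of $n$-types $\tau$, $\tau'$. For $G\subseteq Char^n_2$ let $\mathcal G^\alpha_G$ be the game $\mathcal G^\alpha_\varphi$ with $\varphi=\bigvee_{\tau\in G}\tau$, and put $$\text{game-type}_n(\alpha)=\{G\subseteq Char^n_2 : \text{Player I has a winning strategy in } \mathcal G^\alpha_G\}.$$ For $G\subseteq Char^n_2$ and $C\subseteq\mathcal P(Char^n_2)$ put $K(C,G)=\bigcup_{G'\in C}\{\tau\in Char^n_2 : \tau+\tau'\in G\text{ for all }\tau'\in G'\}$. **Theorem.** Let $\alpha,\beta>0$ be determinate ordinals. 1. $\alpha+\beta$ is determinate. 2. For all $n\in\mathbb N$ and $G\subseteq Char^n_2$, with $C_\beta=\text{game-type}_n(\beta)$: (A) if Player I wins $\mathcal G^\alpha_{K(C_\beta,G)}$,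 then Player I wins $\mathcal G^{\alpha+\beta}_G$; (B) if Player I has no winning strategy in $\mathcal G^\alpha_{K(C_\beta,G)}$, then Player II wins $\mathcal G^{\alpha+\beta}_G$; hence $G\in\text{game-type}_n(\alpha+\beta)$ if and only if $K(C_\beta,G)\in\text{game-type}_n(\alpha)$. 3. $\text{game-type}_n(\alpha+\beta)$ is computable from $\text{game-type}_n(\alpha)$ and $\text{game-type}_n(\beta)$, uniformly: there is a single computable function (on finite objects given by Gödel numbers of formulas) that maps $n$, $\text{game-type}_n(\alpha)$ and $\text{game-type}_n(\beta)$ to $\text{game-type}_n(\alpha+\beta)$, for all $n$ and all determinate ordinals $\alpha,\beta>0$. -/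

import Mathlib

/-! ## Syntax and semantics of the monadic logic of order -/

/-- Formulas of the monadic logic of order. The individual variables are `t_0, t_1, …` and the set
variables are `X_0, X_1, …`; both are referred to by their index. `fls` is the empty disjunction
(falsity), which is counted among the Boolean connectives. -/
inductive MLO : Type
  | fls : MLO
  | mem (i t : ℕ) : MLO
  | lt (s t : ℕ) : MLO
  | neg (φ : MLO) : MLO
  | or (φ ψ : MLO) : MLO
  | and (φ ψ : MLO) : MLO
  | imp (φ ψ : MLO) : MLO
  | ex (t : ℕ) (φ : MLO) : MLO
  | all (t : ℕ) (φ : MLO) : MLO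
  | exSet (i : ℕ) (φ : MLO) : MLO
  | allSet (i : ℕ) (φ : MLO) : MLO
  deriving DecidableEq

namespace MLO

/-- The free individual variables. -/
def freeInd : MLO → Finset ℕ
  | fls => ∅
  | mem _ t => {t}
  | lt s t => {s, t}
  | neg φ => φ.freeInd
  | or φ ψ => φ.freeInd ∪ ψ.freeInd
  | and φ ψ => φ.freeInd ∪ ψ.freeInd
  | imp φ ψ => φ.freeInd ∪ ψ.freeInd
  | ex t φ => φ.freeInd.erase t
  | all t φ => φ.freeInd.erase t
  | exSet _ φ => φ.freeInd
  | allSet _ φ => φ.freeInd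

/-- The free set variables. -/
def freeSet : MLO → Finset ℕ
  | fls => ∅
  | mem i _ => {i}
  | lt _ _ => ∅
  | neg φ => φ.freeSet
  | or φ ψ => φ.freeSet ∪ ψ.freeSet
  | and φ ψ => φ.freeSet ∪ ψ.freeSet
  | imp φ ψ => φ.freeSet ∪ ψ.freeSet
  | ex _ φ => φ.freeSet
  | all _ φ => φ.freeSet
  | exSet i φ => φ.freeSet.erase i
  | allSet i φ => φ.freeSet.erase i

/-- The formula is of the form `φ(X_0, X_1)`: its only free variables are the set variables `X_0`
and `X_1`. -/
def IsBinary (φ : MLO) : Prop :=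
  φ.freeInd = ∅ ∧ φ.freeSet ⊆ {0, 1}

/-- Satisfaction in `(A, <)` under an assignment `v` of the individual variables and an assignment
`V` of the set variables; set quantifiers range over all subsets of `A`. -/
def Sat {A : Type*} [LT A] : (ℕ → A) → (ℕ → Set A) → MLO → Prop
  | _, _, fls => False
  | v, V, mem i t => v t ∈ V i
  | v, _, lt s t => v s < v t
  | v, V, neg φ => ¬ Sat v V φ
  | v, V, or φ ψ => Sat v V φ ∨ Sat v V ψ
  | v, V, and φ ψ => Sat v V φ ∧ Sat v V ψ
  | v, V, imp φ ψ => Sat v V φ → Sat v V ψ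
  | v, V, ex t φ => ∃ a : A, Sat (Function.update v t a) V φ
  | v, V, all t φ => ∀ a : A, Sat (Function.update v t a) V φ
  | v, V, exSet i φ => ∃ S : Set A, Sat v (Function.update V i S) φ
  | v, V, allSet i φ => ∀ S : Set A, Sat v (Function.update V i S) φ

/-- The assignment `X_0 ↦ P`, `X_1 ↦ Q`, and `X_i ↦ ∅` otherwise. -/
def assign {A : Type*} (P Q : Set A) : ℕ → Set A
  | 0 => P
  | 1 => Q
  | _ => ∅

/-- `(A, <) ⊨ φ(P, Q)`, for `φ` of the form `φ(X_0, X_1)` and nonempty `A`. -/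
def Models {A : Type*} [LT A] (φ : MLO) (P Q : Set A) : Prop :=
  ∀ v : ℕ → A, Sat v (assign P Q) φ

/-- Finite conjunctions; the empty conjunction is true. -/
def bigAnd : List MLO → MLO
  | [] => neg fls
  | φ :: L => and φ (bigAnd L)

/-- Finite disjunctions; the empty disjunction is false. -/
def bigOr : List MLO → MLO
  | [] => fls
  | φ :: L => or φ (bigOr L)

/-- The disjunction of all formulas in a finite set. -/
noncomputable def disj (G : Finset MLO) : MLO :=
  bigOr G.toList

/-- A Gödel numbering of formulas. -/
def code : MLO → ℕ
  | fls => Nat.pair 0 0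
  | mem i t => Nat.pair 1 (Nat.pair i t)
  | lt s t => Nat.pair 2 (Nat.pair s t)
  | neg φ => Nat.pair 3 φ.code
  | or φ ψ => Nat.pair 4 (Nat.pair φ.code ψ.code)
  | and φ ψ => Nat.pair 5 (Nat.pair φ.code ψ.code)
  | imp φ ψ => Nat.pair 6 (Nat.pair φ.code ψ.code)
  | ex t φ => Nat.pair 7 (Nat.pair t φ.code)
  | all t φ => Nat.pair 8 (Nat.pair t φ.code)
  | exSet i φ => Nat.pair 9 (Nat.pair i φ.code)
  | allSet i φ => Nat.pair 10 (Nat.pair i φ.code)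

theorem code_injective : Function.Injective code := by
  intro φ
  induction φ <;> intro ψ h <;> cases ψ <;> simp_all [code, Nat.pair_eq_pair]
  all_goals grind

/-! ## Characteristic (Hintikka) formulas -/

/-- The atomic formulas in the variables `t_i` (`i < k`) and `X_j` (`j < l`). -/
def atoms (k l : ℕ) : List MLO :=
  ((List.range l ×ˢ List.range k).map fun p => mem p.1 p.2) ++
    ((List.range k ×ˢ List.range k).map fun p => lt p.1 p.2)

/-- All ways of replacing some of the members of a list of formulas by their negations. -/
def signed : List MLO → List (List MLO)
  | [] => [[]]
  | φ :: L => (signed L).map (φ :: ·) ++ (signed L).map (neg φ :: ·)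

/-- The formula saying that, for `t_k` ranging over the elements, exactly the formulas from `S` are
realized, and for `X_l` ranging over the subsets, exactly the formulas from `T` are realized (when
`S` and `T` are taken from lists of pairwise exclusive, jointly exhaustive formulas). -/
def realizes (k l : ℕ) (S T : List MLO) : MLO :=
  and (and (bigAnd (S.map (ex k))) (all k (bigOr S)))
    (and (bigAnd (T.map (exSet l))) (allSet l (bigOr T)))

/-- The characteristic formulas of quantifier depth `n` in the free variables `t_i` (`i < k`) and
`X_j` (`j < l`). -/
def hintikka : ℕ → ℕ → ℕ → List MLO
  | 0, k, l => (signed (atoms k l)).map bigAnd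
  | n + 1, k, l =>
      ((hintikka n (k + 1) l).sublists ×ˢ (hintikka n k (l + 1)).sublists).map
        fun p => realizes k l p.1 p.2

/-- The finite set of characteristic formulas of quantifier depth `n` with free variables among
`X_0, X_1`. -/
def Char2 (n : ℕ) : Finset MLO :=
  (hintikka n 0 2).toFinset

theorem bigAnd_injective : Function.Injective bigAnd := by
  intro S
  induction S with
  | nil => intro T h; cases T <;> simp_all [bigAnd]
  | cons a S ih =>
    intro T h
    cases T with
    | nil => simp [bigAnd] at h
    | cons b T => simp only [bigAnd, and.injEq] at h; rw [h.1, ih h.2]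

theorem bigOr_injective : Function.Injective bigOr := by
  intro S
  induction S with
  | nil => intro T h; cases T <;> simp_all [bigOr]
  | cons a S ih =>
    intro T h
    cases T with
    | nil => simp [bigOr] at h
    | cons b T => simp only [bigOr, or.injEq] at h; rw [h.1, ih h.2]

theorem sat_bigAnd {A : Type*} [LT A] (v : ℕ → A) (V : ℕ → Set A) (S : List MLO) :
    Sat v V (bigAnd S) ↔ ∀ φ ∈ S, Sat v V φ := by
  induction S <;> simp_all [bigAnd, Sat]

theorem sat_bigOr {A : Type*} [LT A] (v : ℕ → A) (V : ℕ → Set A) (S : List MLO) :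
    Sat v V (bigOr S) ↔ ∃ φ ∈ S, Sat v V φ := by
  induction S <;> simp_all [bigOr, Sat]

theorem nodup_signed (L : List MLO) : (signed L).Nodup := by
  induction L with
  | nil => simp [signed]
  | cons a L ih =>
    have hne : neg a ≠ a := fun h => by
      have := congrArg sizeOf h
      simp at this
    rw [signed, List.nodup_append]
    refine ⟨ih.map (List.cons_injective), ih.map (List.cons_injective), ?_⟩
    simp only [List.mem_map]
    rintro _ ⟨x, _, rfl⟩ _ ⟨y, _, rfl⟩ h
    exact hne (List.cons.inj h).1.symm

theorem nodup_hintikka (n k l : ℕ) : (hintikka n k l).Nodup := by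
  induction n generalizing k l with
  | zero => exact (nodup_signed _).map bigAnd_injective
  | succ n ih =>
    refine List.Nodup.map ?_
      ((List.nodup_sublists.2 (ih _ _)).product (List.nodup_sublists.2 (ih _ _)))
    rintro ⟨S, T⟩ ⟨S', T'⟩ h
    simp only [realizes, and.injEq, all.injEq, allSet.injEq, true_and] at h
    rw [bigOr_injective h.1.2, bigOr_injective h.2.2]

theorem existsUnique_signed {A : Type*} [LT A] (v : ℕ → A) (V : ℕ → Set A) (L : List MLO) :
    ∃! S, S ∈ signed L ∧ ∀ φ ∈ S, Sat v V φ := by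
  induction L with
  | nil => exact ⟨[], by simp [signed], by simp [signed]⟩
  | cons a L ih =>
    obtain ⟨S, ⟨hS, hS'⟩, hu⟩ := ih
    by_cases ha : Sat v V a
    · refine ⟨a :: S, ⟨by simp [signed, hS], by simpa [ha] using hS'⟩, ?_⟩
      rintro T ⟨hT, hT'⟩
      simp only [signed, List.mem_append, List.mem_map] at hT
      obtain ⟨T, h, rfl⟩ | ⟨T, h, rfl⟩ := hT
      · rw [hu T ⟨h, fun φ hφ => hT' φ (by simp [hφ])⟩]
      · exact absurd ha (hT' (neg a) (by simp))
    · refine ⟨neg a :: S, ⟨by simp [signed, hS], by simpa [Sat, ha] using hS'⟩, ?_⟩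
      rintro T ⟨hT, hT'⟩
      simp only [signed, List.mem_append, List.mem_map] at hT
      obtain ⟨T, h, rfl⟩ | ⟨T, h, rfl⟩ := hT
      · exact absurd (hT' a (by simp)) ha
      · rw [hu T ⟨h, fun φ hφ => hT' φ (by simp [hφ])⟩]

theorem existsUnique_sublist {X : Type*} (L : List MLO) (hL : L.Nodup) (R : X → MLO → Prop)
    (h : ∀ x, ∃! φ, φ ∈ L ∧ R x φ) :
    ∃! S, S ∈ L.sublists ∧ (∀ φ ∈ S, ∃ x, R x φ) ∧ ∀ x, ∃ φ ∈ S, R x φ := by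
  classical
  refine ⟨L.filter fun φ => decide (∃ x, R x φ), ⟨?_, ?_, ?_⟩, ?_⟩
  · exact List.mem_sublists.2 List.filter_sublist
  · simp
  · intro x
    obtain ⟨φ, ⟨hφ, hx⟩, -⟩ := h x
    exact ⟨φ, by simpa [hφ] using ⟨x, hx⟩, hx⟩
  · rintro S ⟨hS, h1, h2⟩
    rw [List.mem_sublists] at hS
    have key : ∀ φ, φ ∈ S ↔ φ ∈ L ∧ ∃ x, R x φ := by
      intro φ
      refine ⟨fun hφ => ⟨hS.subset hφ, h1 φ hφ⟩, ?_⟩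
      rintro ⟨hφ, x, hx⟩
      obtain ⟨ψ, hψ, hxψ⟩ := h2 x
      rwa [(h x).unique ⟨hφ, hx⟩ ⟨hS.subset hψ, hxψ⟩]
    have hs : S.Sublist (L.filter fun φ => decide (∃ x, R x φ)) := by
      have := hS.filter fun φ => decide (∃ x, R x φ)
      rwa [List.filter_eq_self.2 fun φ hφ => decide_eq_true (h1 φ hφ)] at this
    refine hs.eq_of_length_le ?_
    exact ((hL.filter _).subperm fun φ hφ => (key φ).2 (by simpa using hφ)).length_le

/-- Every structure with an assignment satisfies exactly one characteristic formula. -/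
theorem existsUnique_hintikka {A : Type*} [LT A] (n k l : ℕ) (v : ℕ → A) (V : ℕ → Set A) :
    ∃! φ, φ ∈ hintikka n k l ∧ Sat v V φ := by
  induction n generalizing k l v V with
  | zero =>
    obtain ⟨S, ⟨hS, hS'⟩, hu⟩ := existsUnique_signed v V (atoms k l)
    refine ⟨bigAnd S, ⟨List.mem_map.2 ⟨S, hS, rfl⟩, (sat_bigAnd _ _ _).2 hS'⟩, ?_⟩
    rintro _ ⟨hφ, hφ'⟩
    obtain ⟨T, hT, rfl⟩ := List.mem_map.1 hφ
    rw [hu T ⟨hT, (sat_bigAnd _ _ _).1 hφ'⟩]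
  | succ n ih =>
    obtain ⟨S, ⟨hS, hS1, hS2⟩, hSu⟩ := existsUnique_sublist (hintikka n (k + 1) l)
      (nodup_hintikka _ _ _) (fun (a : A) φ => Sat (Function.update v k a) V φ)
      (fun a => ih _ _ _ _)
    obtain ⟨T, ⟨hT, hT1, hT2⟩, hTu⟩ := existsUnique_sublist (hintikka n k (l + 1))
      (nodup_hintikka _ _ _) (fun (a : Set A) φ => Sat v (Function.update V l a) φ)
      (fun a => ih _ _ _ _)
    refine ⟨realizes k l S T, ⟨List.mem_map.2 ⟨(S, T), List.pair_mem_product.2 ⟨hS, hT⟩, rfl⟩, ?_⟩, ?_⟩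
    · simp only [realizes, Sat, sat_bigAnd, sat_bigOr, List.mem_map]
      refine ⟨⟨?_, hS2⟩, ?_, hT2⟩
      · rintro _ ⟨φ, hφ, rfl⟩; exact hS1 φ hφ
      · rintro _ ⟨φ, hφ, rfl⟩; exact hT1 φ hφ
    · rintro _ ⟨hφ, hs⟩
      obtain ⟨⟨S', T'⟩, hm, rfl⟩ := List.mem_map.1 hφ
      replace hm := List.pair_mem_product.1 hm
      simp only [realizes, Sat, sat_bigAnd, sat_bigOr, List.mem_map] at hs
      obtain ⟨⟨h1, h2⟩, h3, h4⟩ := hs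
      rw [hSu S' ⟨hm.1, fun φ hφ => h1 _ ⟨φ, hφ, rfl⟩, h2⟩,
        hTu T' ⟨hm.2, fun φ hφ => h3 _ ⟨φ, hφ, rfl⟩, h4⟩]

/-! ## Sums of types -/

/-- The subset of the ordered sum `A ⊕ₗ B` whose traces on `A` and `B` are `P` and `Q`. -/
def sumSet {A B : Type*} (P : Set A) (Q : Set B) : Set (A ⊕ₗ B) :=
  {x | Sum.elim (· ∈ P) (· ∈ Q) (ofLex x)}

/-- `τ` is a sum of the characteristic formulas `τ₀` and `τ₁`: it is a characteristic formula, and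
it is the `n`-type of `M₀ + M₁` for all chains `M₀` of `n`-type `τ₀` and `M₁` of `n`-type `τ₁`. (The
`n`-type of a structure is the unique member of `Char2 n` that it satisfies.) -/
def IsTypeSum.{w} (n : ℕ) (τ₀ τ₁ τ : MLO) : Prop :=
  τ ∈ Char2 n ∧
    ∀ (A B : Type w) [LinearOrder A] [LinearOrder B] [Nonempty A] [Nonempty B]
      (P₀ Q₀ : Set A) (P₁ Q₁ : Set B),
      Models τ₀ P₀ Q₀ → Models τ₁ P₁ Q₁ → Models τ (sumSet P₀ P₁) (sumSet Q₀ Q₁)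

/-- The sum `τ₀ + τ₁` of two characteristic formulas of depth `n`. It is determined by its defining
property, except that it is an arbitrary member of `Char2 n` if `τ₀` or `τ₁` has no chain as a
model. -/
noncomputable def typeSum.{w} (n : ℕ) (τ₀ τ₁ : MLO) : MLO :=
  haveI : Nonempty MLO := ⟨fls⟩
  Classical.epsilon (IsTypeSum.{w} n τ₀ τ₁)

end MLO

/-! ## Games -/

/-- `f` is causal: if `P` and `P'` agree up to and including `b`, then so do `f P` and `f P'`. -/
def Causal {A : Type*} [LinearOrder A] (f : Set A → Set A) : Prop :=
  ∀ (P P' : Set A) (b : A), P ∩ Set.Iic b = P' ∩ Set.Iic b → f P ∩ Set.Iic b = f P' ∩ Set.Iic b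

/-- `f` is strongly causal: if `P` and `P'` agree below `b`, then `f P` and `f P'` agree up to and
including `b`. -/
def StronglyCausal {A : Type*} [LinearOrder A] (f : Set A → Set A) : Prop :=
  ∀ (P P' : Set A) (b : A), P ∩ Set.Iio b = P' ∩ Set.Iio b → f P ∩ Set.Iic b = f P' ∩ Set.Iic b

/-- Player I has a winning strategy in the game of length `α` with winning condition `φ`. -/
def PlayerIWins (α : Ordinal) (φ : MLO) : Prop :=
  ∃ f : Set α.ToType → Set α.ToType, StronglyCausal f ∧ ∀ P, MLO.Models φ (f P) P

/-- Player II has a winning strategy in the game of length `α` with winning condition `φ`. -/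
def PlayerIIWins (α : Ordinal) (φ : MLO) : Prop :=
  ∃ f : Set α.ToType → Set α.ToType, Causal f ∧ ∀ P, MLO.Models (MLO.neg φ) P (f P)

/-- Games are considered for lengths `α > 0`. Such an `α` is determinate if for every formula
`φ(X_0, X_1)` one of the players has a winning strategy in the game of length `α` for `φ`. -/
def Determinate (α : Ordinal) : Prop :=
  0 < α ∧ ∀ φ : MLO, φ.IsBinary → PlayerIWins α φ ∨ PlayerIIWins α φ

open Classical in
/-- The set of all `G ⊆ Char2 n` such that Player I wins the game of length `α` whose winning
condition is the disjunction of the formulas in `G`. -/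
noncomputable def gameType (n : ℕ) (α : Ordinal) : Finset (Finset MLO) :=
  (MLO.Char2 n).powerset.filter fun G => PlayerIWins α (MLO.disj G)

open Classical in
/-- `K(G', G)`: the characteristic formulas `τ` with `τ + τ' ∈ G` for all `τ' ∈ G'`. -/
noncomputable def kSet.{w} (n : ℕ) (G' G : Finset MLO) : Finset MLO :=
  (MLO.Char2 n).filter fun τ => ∀ τ' ∈ G', MLO.typeSum.{w} n τ τ' ∈ G

/-- `K(C, G)`: the union of the sets `K(G', G)` over `G' ∈ C`. -/
noncomputable def kUnion.{w} (n : ℕ) (C : Finset (Finset MLO)) (G : Finset MLO) : Finset MLO :=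
  C.biUnion fun G' => kSet.{w} n G' G

/-- The list `L` of lists of numbers represents the finite set `C` of finite sets of formulas, each
formula being given by its Gödel number (order and repetitions in the lists being irrelevant). -/
def Represents (L : List (List ℕ)) (C : Finset (Finset MLO)) : Prop :=
  (L.map List.toFinset).toFinset = C.image fun G => G.image MLO.code

universe u

/-!
Two facts carry the proof. The first is the composition theorem for the monadic logic of order: the
`n`-type of a sum `M + M'` is determined by the `n`-types of `M` and `M'`. It is proved in an
effective form. `MLO.sumTable` lists all triples `(φ, ψ, χ)` of characteristic formulas such that
`χ` is the type of a sum of structures of types `φ` and `ψ`; it is defined by recursion on the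
quantifier depth, following the recursion that defines the characteristic formulas, and its
correctness is `MLO.sat_of_mem_sumTable`. In this recursion the individual variables that have
already been quantified are distributed over the two summands; a variable with its value in one
summand keeps a dummy value in the other, so that no variable has to be renamed.

The second fact concerns games. A game of length `α + β` is a game of length `α` followed by one of
length `β`, and all that matters about the first is the type `τ` that it produces. Player I plays
for a type in `K(C, G)`, which by definition comes with a set `G'` that she can enforce in the
second game and for which all sums `τ + τ'` with `τ' ∈ G'` are in `G` (`playerIWins_add`). If she
cannot enforce `K(C, G)`, then by determinacy Player II can avoid it. The set of all `τ'` with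
`τ + τ' ∈ G` is then not in `C`, so by determinacy Player II can avoid it in the second game
(`playerIIWins_add`). The players cannot both have winning strategies, since on a well-order any two
strategies have a common play (`IWins.not_iiWins`); this gives the description of the game type of
`α + β`. As every formula is equivalent over chains to a disjunction of characteristic formulas
(`MLO.IsBinary.exists_equiv_disj`), it follows that `α + β` is determinate.

The sum `typeSum` is an arbitrary choice on types that no chain realizes, and need not agree there
with the sum table. Hence the results on games are stated for an arbitrary relation `S` that assigns
to any two types some sum of theirs (`IsSumRel`), and are used both for `typeSum` and for the sum
table. For the latter, `K(C, G)` is primitive recursive: the Gödel numbering makes formulas a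
`Primcodable` type, on which the characteristic formulas (`MLO.primrec_hintikka`) and the sum table
(`MLO.primrec_sumTable`) are primitive recursive.
-/

namespace MLO

/-! ### Free variables, isomorphisms, quantifier depth -/

/-- Satisfaction depends only on the values of the free variables. -/
theorem sat_congr {A : Type*} [LT A] (φ : MLO) {v w : ℕ → A} {V W : ℕ → Set A}
    (hv : ∀ t ∈ φ.freeInd, v t = w t) (hV : ∀ i ∈ φ.freeSet, V i = W i) :
    Sat v V φ ↔ Sat w W φ := by
  induction φ generalizing v w V W with
  | fls => rfl
  | mem i t => simp only [Sat]; rw [hv t (by simp [freeInd]), hV i (by simp [freeSet])]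
  | lt s t => simp only [Sat]; rw [hv t (by simp [freeInd]), hv s (by simp [freeInd])]
  | neg φ ih => exact not_congr (ih hv hV)
  | or φ ψ ih₁ ih₂ | and φ ψ ih₁ ih₂ | imp φ ψ ih₁ ih₂ =>
    simp only [freeInd, freeSet, Finset.mem_union] at hv hV
    simp only [Sat]
    rw [ih₁ (fun t h => hv t (.inl h)) (fun t h => hV t (.inl h)),
      ih₂ (fun t h => hv t (.inr h)) (fun t h => hV t (.inr h))]
  | ex t φ ih =>
    refine exists_congr fun a => ih (fun s hs => ?_) hV
    by_cases h : s = t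
    · subst h; simp
    · simpa [h] using hv s (by simp [freeInd, h, hs])
  | all t φ ih =>
    refine forall_congr' fun a => ih (fun s hs => ?_) hV
    by_cases h : s = t
    · subst h; simp
    · simpa [h] using hv s (by simp [freeInd, h, hs])
  | exSet t φ ih =>
    refine exists_congr fun a => ih hv (fun s hs => ?_)
    by_cases h : s = t
    · subst h; simp
    · simpa [h] using hV s (by simp [freeSet, h, hs])
  | allSet t φ ih =>
    refine forall_congr' fun a => ih hv (fun s hs => ?_)
    by_cases h : s = t
    · subst h; simp
    · simpa [h] using hV s (by simp [freeSet, h, hs])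

/-- Satisfaction is invariant under order isomorphisms. -/
theorem sat_orderIso {A B : Type*} [LinearOrder A] [LinearOrder B] (e : A ≃o B) (φ : MLO)
    (v : ℕ → A) (V : ℕ → Set A) :
    Sat (e ∘ v) (fun i => e '' V i) φ ↔ Sat v V φ := by
  have hind : ∀ (v : ℕ → A) t a, Function.update (e ∘ v) t (e a) = e ∘ Function.update v t a :=
    fun v t a => (Function.comp_update e v t a).symm
  have hset : ∀ (V : ℕ → Set A) i S, Function.update (fun i => e '' V i) i (e '' S)
      = fun j => e '' Function.update V i S j := by
    intro V i S; funext j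
    by_cases h : j = i
    · subst h; simp
    · simp [h]
  induction φ generalizing v V with
  | fls => rfl
  | mem i t => simp [Sat]
  | lt s t => simp [Sat]
  | neg φ ih => exact not_congr (ih v V)
  | or φ ψ ih₁ ih₂ | and φ ψ ih₁ ih₂ | imp φ ψ ih₁ ih₂ => simp only [Sat, ih₁, ih₂]
  | ex t φ ih => simp only [Sat, e.surjective.exists, hind, ih]
  | all t φ ih => simp only [Sat, e.surjective.forall, hind, ih]
  | exSet t φ ih => simp only [Sat, e.surjective.image_surjective.exists, hset, ih]
  | allSet t φ ih => simp only [Sat, e.surjective.image_surjective.forall, hset, ih]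

/-- The quantifier depth of a formula. -/
def depth : MLO → ℕ
  | fls => 0
  | mem _ _ => 0
  | lt _ _ => 0
  | neg φ => φ.depth
  | or φ ψ => max φ.depth ψ.depth
  | and φ ψ => max φ.depth ψ.depth
  | imp φ ψ => max φ.depth ψ.depth
  | ex _ φ => φ.depth + 1
  | all _ φ => φ.depth + 1
  | exSet _ φ => φ.depth + 1
  | allSet _ φ => φ.depth + 1

theorem freeInd_bigAnd {S : List MLO} {s : Finset ℕ} (h : ∀ φ ∈ S, φ.freeInd ⊆ s) :
    (bigAnd S).freeInd ⊆ s := by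
  induction S with
  | nil => simp [bigAnd, freeInd]
  | cons a S ih => simp_all [bigAnd, freeInd, Finset.union_subset_iff]

theorem freeSet_bigAnd {S : List MLO} {s : Finset ℕ} (h : ∀ φ ∈ S, φ.freeSet ⊆ s) :
    (bigAnd S).freeSet ⊆ s := by
  induction S with
  | nil => simp [bigAnd, freeSet]
  | cons a S ih => simp_all [bigAnd, freeSet, Finset.union_subset_iff]

theorem freeInd_bigOr {S : List MLO} {s : Finset ℕ} (h : ∀ φ ∈ S, φ.freeInd ⊆ s) :
    (bigOr S).freeInd ⊆ s := by
  induction S with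
  | nil => simp [bigOr, freeInd]
  | cons a S ih => simp_all [bigOr, freeInd, Finset.union_subset_iff]

theorem freeSet_bigOr {S : List MLO} {s : Finset ℕ} (h : ∀ φ ∈ S, φ.freeSet ⊆ s) :
    (bigOr S).freeSet ⊆ s := by
  induction S with
  | nil => simp [bigOr, freeSet]
  | cons a S ih => simp_all [bigOr, freeSet, Finset.union_subset_iff]

theorem mem_or_neg_mem_of_mem_signed {L S : List MLO} (hS : S ∈ signed L) {φ : MLO} (hφ : φ ∈ L) :
    φ ∈ S ∨ neg φ ∈ S := by
  induction L generalizing S with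
  | nil => simp at hφ
  | cons a L ih =>
    simp only [signed, List.mem_append, List.mem_map] at hS
    obtain ⟨T, hT, rfl⟩ | ⟨T, hT, rfl⟩ := hS <;> rcases List.mem_cons.1 hφ with rfl | h
    · simp
    · rcases ih hT h with h | h <;> simp [h]
    · simp
    · rcases ih hT h with h | h <;> simp [h]

theorem eq_or_eq_neg_of_mem_signed {L S : List MLO} (hS : S ∈ signed L) {φ : MLO} (hφ : φ ∈ S) :
    ∃ ψ ∈ L, φ = ψ ∨ φ = neg ψ := by
  induction L generalizing S with
  | nil => simp [signed] at hS; simp [hS] at hφ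
  | cons a L ih =>
    simp only [signed, List.mem_append, List.mem_map] at hS
    obtain ⟨T, hT, rfl⟩ | ⟨T, hT, rfl⟩ := hS <;> rcases List.mem_cons.1 hφ with rfl | h
    · simp
    · obtain ⟨ψ, h1, h2⟩ := ih hT h; exact ⟨ψ, by simp [h1], h2⟩
    · simp
    · obtain ⟨ψ, h1, h2⟩ := ih hT h; exact ⟨ψ, by simp [h1], h2⟩

theorem mem_atoms {k l : ℕ} {φ : MLO} :
    φ ∈ atoms k l ↔ (∃ i t, i < l ∧ t < k ∧ mem i t = φ) ∨ ∃ s t, s < k ∧ t < k ∧ lt s t = φ := by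
  simp [atoms, and_assoc]

theorem mem_hintikka_succ {n k l : ℕ} {φ : MLO} :
    φ ∈ hintikka (n + 1) k l ↔ ∃ S T, S.Sublist (hintikka n (k + 1) l) ∧
      T.Sublist (hintikka n k (l + 1)) ∧ realizes k l S T = φ := by
  simp [hintikka, and_assoc]

/-- The free variables of a characteristic formula. -/
theorem free_hintikka {n k l : ℕ} {φ : MLO} (h : φ ∈ hintikka n k l) :
    φ.freeInd ⊆ Finset.range k ∧ φ.freeSet ⊆ Finset.range l := by
  induction n generalizing k l φ with
  | zero =>
    obtain ⟨S, hS, rfl⟩ := List.mem_map.1 h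
    have key : ∀ φ ∈ S, φ.freeInd ⊆ Finset.range k ∧ φ.freeSet ⊆ Finset.range l := by
      intro φ hφ
      obtain ⟨ψ, hψ, rfl | rfl⟩ := eq_or_eq_neg_of_mem_signed hS hφ <;>
      obtain ⟨i, t, hi, ht, rfl⟩ | ⟨i, t, hi, ht, rfl⟩ := mem_atoms.1 hψ <;>
      simp [freeInd, freeSet, Finset.insert_subset_iff, hi, ht]
    exact ⟨freeInd_bigAnd fun φ hφ => (key φ hφ).1, freeSet_bigAnd fun φ hφ => (key φ hφ).2⟩
  | succ n ih =>
    obtain ⟨S, T, hS, hT, rfl⟩ := mem_hintikka_succ.1 h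
    have hS' : ∀ φ ∈ S, φ.freeInd.erase k ⊆ Finset.range k ∧ φ.freeSet ⊆ Finset.range l := by
      intro φ hφ
      obtain ⟨h1, h2⟩ := ih (hS.subset hφ)
      rw [Finset.range_add_one] at h1
      exact ⟨Finset.subset_insert_iff.1 h1, h2⟩
    have hT' : ∀ φ ∈ T, φ.freeInd ⊆ Finset.range k ∧ φ.freeSet.erase l ⊆ Finset.range l := by
      intro φ hφ
      obtain ⟨h1, h2⟩ := ih (hT.subset hφ)
      rw [Finset.range_add_one] at h2
      exact ⟨h1, Finset.subset_insert_iff.1 h2⟩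
    simp only [realizes, freeInd, freeSet, Finset.union_subset_iff, ← Finset.subset_insert_iff]
    refine ⟨⟨⟨freeInd_bigAnd ?_, freeInd_bigOr ?_⟩, freeInd_bigAnd ?_, freeInd_bigOr ?_⟩,
      ⟨freeSet_bigAnd ?_, freeSet_bigOr ?_⟩, freeSet_bigAnd ?_, freeSet_bigOr ?_⟩ <;>
    simp +contextual [freeInd, freeSet, Finset.subset_insert_iff, hS', hT']

theorem sat_realizes {A : Type*} [LT A] {v : ℕ → A} {V : ℕ → Set A} {k l : ℕ} {S T : List MLO} :
    Sat v V (realizes k l S T) ↔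
      ((∀ φ ∈ S, ∃ a, Sat (Function.update v k a) V φ) ∧
        ∀ a, ∃ φ ∈ S, Sat (Function.update v k a) V φ) ∧
      (∀ φ ∈ T, ∃ P, Sat v (Function.update V l P) φ) ∧
        ∀ P, ∃ φ ∈ T, Sat v (Function.update V l P) φ := by
  simp [realizes, Sat, sat_bigAnd, sat_bigOr]

/-! ### Equal types decide the same formulas -/

section SameType

variable {A B : Type*} [LT A] [LT B] {n k l : ℕ} {χ : MLO} {v : ℕ → A} {V : ℕ → Set A}
  {w : ℕ → B} {W : ℕ → Set B}

/-- The back-and-forth property for elements. -/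
theorem exists_sat_update (hχ : χ ∈ hintikka (n + 1) k l) (h : Sat v V χ) (h' : Sat w W χ) (a : A) :
    ∃ b : B, ∃ ψ ∈ hintikka n (k + 1) l,
      Sat (Function.update v k a) V ψ ∧ Sat (Function.update w k b) W ψ := by
  obtain ⟨S, T, hS, hT, rfl⟩ := mem_hintikka_succ.1 hχ
  rw [sat_realizes] at h h'
  obtain ⟨ψ, hψ, hs⟩ := h.1.2 a
  obtain ⟨b, hb⟩ := h'.1.1 ψ hψ
  exact ⟨b, ψ, hS.subset hψ, hs, hb⟩

/-- The back-and-forth property for subsets. -/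
theorem exists_sat_updateSet (hχ : χ ∈ hintikka (n + 1) k l) (h : Sat v V χ) (h' : Sat w W χ)
    (P : Set A) : ∃ Q : Set B, ∃ ψ ∈ hintikka n k (l + 1),
      Sat v (Function.update V l P) ψ ∧ Sat w (Function.update W l Q) ψ := by
  obtain ⟨S, T, hS, hT, rfl⟩ := mem_hintikka_succ.1 hχ
  rw [sat_realizes] at h h'
  obtain ⟨ψ, hψ, hs⟩ := h.2.2 P
  obtain ⟨b, hb⟩ := h'.2.1 ψ hψ
  exact ⟨b, ψ, hT.subset hψ, hs, hb⟩

/-- Structures of the same `n`-type, for any `n`, satisfy the same atomic formulas. -/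
theorem sat_atom_iff (hχ : χ ∈ hintikka n k l) (h : Sat v V χ) (h' : Sat w W χ) {φ : MLO}
    (hφ : φ ∈ atoms k l) : Sat v V φ ↔ Sat w W φ := by
  induction n generalizing k v w χ with
  | zero =>
    obtain ⟨S, hS, rfl⟩ := List.mem_map.1 hχ
    rw [sat_bigAnd] at h h'
    rcases mem_or_neg_mem_of_mem_signed hS hφ with hm | hm
    · exact iff_of_true (h _ hm) (h' _ hm)
    · exact iff_of_false (h _ hm) (h' _ hm)
  | succ n ih =>
    -- A new variable `t_k`, with value `v 0` on the left, lowers the depth without affecting the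
    -- atoms in the old variables.
    obtain ⟨b, ψ, hψ, h1, h2⟩ := exists_sat_update hχ h h' (v 0)
    have := ih hψ h1 h2 (mem_atoms.2 <| (mem_atoms.1 hφ).imp
      (fun ⟨i, t, hi, ht, e⟩ => ⟨i, t, hi, by omega, e⟩)
      (fun ⟨i, t, hi, ht, e⟩ => ⟨i, t, by omega, by omega, e⟩))
    obtain ⟨i, t, hi, ht, rfl⟩ | ⟨i, t, hi, ht, rfl⟩ := mem_atoms.1 hφ
    · simpa [Sat, ht.ne] using this
    · simpa [Sat, ht.ne, hi.ne] using this

/-- If two pairs of assignments take common values on `s` without `t`, then they still do so on `s`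
after new values have been given to `t` and to the fresh index `k`. -/
theorem exists_update_eq {X Y : Type*} {k t : ℕ} {s : Finset ℕ} {v' v : ℕ → X} {w' w : ℕ → Y}
    (a : X) (b : Y) (h : ∀ r ∈ s.erase t, ∃ i < k, v' r = v i ∧ w' r = w i) :
    ∀ r ∈ s, ∃ i < k + 1, Function.update v' t a r = Function.update v k a i ∧
      Function.update w' t b r = Function.update w k b i := by
  intro r hr
  by_cases e : r = t
  · exact ⟨k, by omega, by simp [e]⟩
  · obtain ⟨i, hi, h1, h2⟩ := h r (by simp [e, hr])
    exact ⟨i, by omega, by simp [e, hi.ne, h1, h2]⟩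

/-- Structures of the same `n`-type satisfy the same formulas of quantifier depth at most `n`. To
allow for formulas with arbitrary variables, the formula is evaluated at assignments `v'`, `V'` and
`w'`, `W'` whose relevant values are taken, at the same places, from the assignments whose types are
compared. -/
theorem sat_iff_of_sat_hintikka (hχ : χ ∈ hintikka n k l) (h : Sat v V χ) (h' : Sat w W χ)
    (φ : MLO) (hn : φ.depth ≤ n) {v' : ℕ → A} {V' : ℕ → Set A} {w' : ℕ → B} {W' : ℕ → Set B}
    (hind : ∀ t ∈ φ.freeInd, ∃ i < k, v' t = v i ∧ w' t = w i)
    (hset : ∀ t ∈ φ.freeSet, ∃ i < l, V' t = V i ∧ W' t = W i) :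
    Sat v' V' φ ↔ Sat w' W' φ := by
  induction φ generalizing n k l χ v V w W v' V' w' W' with
  | fls => rfl
  | mem i t =>
    obtain ⟨t', ht, h1, h2⟩ := hind t (by simp [freeInd])
    obtain ⟨i', hi, h3, h4⟩ := hset i (by simp [freeSet])
    have := sat_atom_iff hχ h h' (mem_atoms.2 (.inl ⟨i', t', hi, ht, rfl⟩))
    simpa [Sat, h1, h2, h3, h4] using this
  | lt s t =>
    obtain ⟨t', ht, h1, h2⟩ := hind t (by simp [freeInd])
    obtain ⟨s', hs, h3, h4⟩ := hind s (by simp [freeInd])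
    have := sat_atom_iff hχ h h' (mem_atoms.2 (.inr ⟨s', t', hs, ht, rfl⟩))
    simpa [Sat, h1, h2, h3, h4] using this
  | neg φ ih => exact not_congr (ih hχ h h' hn hind hset)
  | or φ ψ ih₁ ih₂ | and φ ψ ih₁ ih₂ | imp φ ψ ih₁ ih₂ =>
    simp only [freeInd, freeSet, Finset.mem_union] at hind hset
    simp only [depth, max_le_iff] at hn
    simp only [Sat]
    have e₁ := ih₁ hχ h h' hn.1 (fun t h => hind t (.inl h)) (fun t h => hset t (.inl h))
    have e₂ := ih₂ hχ h h' hn.2 (fun t h => hind t (.inr h)) (fun t h => hset t (.inr h))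
    tauto
  | ex t φ ih =>
    obtain ⟨n, rfl⟩ : ∃ m, n = m + 1 := ⟨n - 1, by simp only [depth] at hn; omega⟩
    replace hn : φ.depth ≤ n := by simpa [depth] using hn
    constructor
    · rintro ⟨a, ha⟩
      obtain ⟨b, ψ, hψ, h1, h2⟩ := exists_sat_update hχ h h' a
      exact ⟨b, (ih hψ h1 h2 hn (exists_update_eq _ _ hind) hset).1 ha⟩
    · rintro ⟨b, hb⟩
      obtain ⟨a, ψ, hψ, h1, h2⟩ := exists_sat_update hχ h' h b
      exact ⟨a, (ih hψ h2 h1 hn (exists_update_eq _ _ hind) hset).2 hb⟩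
  | all t φ ih =>
    obtain ⟨n, rfl⟩ : ∃ m, n = m + 1 := ⟨n - 1, by simp only [depth] at hn; omega⟩
    replace hn : φ.depth ≤ n := by simpa [depth] using hn
    constructor
    · intro H b
      obtain ⟨a, ψ, hψ, h1, h2⟩ := exists_sat_update hχ h' h b
      exact (ih hψ h2 h1 hn (exists_update_eq _ _ hind) hset).1 (H a)
    · intro H a
      obtain ⟨b, ψ, hψ, h1, h2⟩ := exists_sat_update hχ h h' a
      exact (ih hψ h1 h2 hn (exists_update_eq _ _ hind) hset).2 (H b)
  | exSet t φ ih =>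
    obtain ⟨n, rfl⟩ : ∃ m, n = m + 1 := ⟨n - 1, by simp only [depth] at hn; omega⟩
    replace hn : φ.depth ≤ n := by simpa [depth] using hn
    constructor
    · rintro ⟨a, ha⟩
      obtain ⟨b, ψ, hψ, h1, h2⟩ := exists_sat_updateSet hχ h h' a
      exact ⟨b, (ih hψ h1 h2 hn hind (exists_update_eq _ _ hset)).1 ha⟩
    · rintro ⟨b, hb⟩
      obtain ⟨a, ψ, hψ, h1, h2⟩ := exists_sat_updateSet hχ h' h b
      exact ⟨a, (ih hψ h2 h1 hn hind (exists_update_eq _ _ hset)).2 hb⟩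
  | allSet t φ ih =>
    obtain ⟨n, rfl⟩ : ∃ m, n = m + 1 := ⟨n - 1, by simp only [depth] at hn; omega⟩
    replace hn : φ.depth ≤ n := by simpa [depth] using hn
    constructor
    · intro H b
      obtain ⟨a, ψ, hψ, h1, h2⟩ := exists_sat_updateSet hχ h' h b
      exact (ih hψ h2 h1 hn hind (exists_update_eq _ _ hset)).1 (H a)
    · intro H a
      obtain ⟨b, ψ, hψ, h1, h2⟩ := exists_sat_updateSet hχ h h' a
      exact (ih hψ h1 h2 hn hind (exists_update_eq _ _ hset)).2 (H b)

end SameType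
end MLO

namespace MLO

/-! ### The sum table of characteristic formulas -/

/-- The formula `φ` or its negation. -/
def lit (b : Bool) (φ : MLO) : MLO := bif b then φ else neg φ

theorem sat_lit {A : Type*} [LT A] {v : ℕ → A} {V : ℕ → Set A} {b : Bool} {φ : MLO} :
    Sat v V (lit b φ) ↔ (b = true ↔ Sat v V φ) := by
  cases b <;> simp [lit, Sat]

theorem map_lit_mem_signed {X : Type*} (L : List X) (g : X → Bool) (h : X → MLO) :
    L.map (fun x => lit (g x) (h x)) ∈ signed (L.map h) := by
  induction L with
  | nil => simp [signed]
  | cons x L ih =>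
    rw [List.map_cons, List.map_cons, signed, List.mem_append]
    cases hx : g x
    · exact .inr (List.mem_map_of_mem ih)
    · exact .inl (List.mem_map_of_mem ih)

theorem append_mem_signed {L L' S S' : List MLO} (h : S ∈ signed L) (h' : S' ∈ signed L') :
    S ++ S' ∈ signed (L ++ L') := by
  induction L generalizing S with
  | nil => simp [signed] at h; simpa [h] using h'
  | cons a L ih =>
    simp only [signed, List.mem_append, List.mem_map] at h
    obtain ⟨T, hT, rfl⟩ | ⟨T, hT, rfl⟩ := h <;> simp [signed, ih hT]

theorem mem_iff_sat_of_mem_signed {A : Type*} [LT A] {v : ℕ → A} {V : ℕ → Set A}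
    {L S : List MLO} (hS : S ∈ signed L) (h : Sat v V (bigAnd S)) {φ : MLO} (hφ : φ ∈ L) :
    φ ∈ S ↔ Sat v V φ := by
  rw [sat_bigAnd] at h
  refine ⟨h φ, fun hs => (mem_or_neg_mem_of_mem_signed hS hφ).resolve_right fun hn => h _ hn hs⟩

/-- The assignment in the ordered sum `A ⊕ₗ B` which takes the value of the `t`-th individual
variable from `A` if the `t`-th entry of `σ` is `true`, and from `B` otherwise. -/
def sumAssign {A B : Type*} (σ : List Bool) (v : ℕ → A) (w : ℕ → B) (t : ℕ) : A ⊕ₗ B :=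
  bif σ.getD t false then toLex (Sum.inl (v t)) else toLex (Sum.inr (w t))

/-- Given the sets `S` and `S'` of literals true in `M` and `M'`, the literals true in `M + M'`,
where `σ` tells which individual variables have their values in `M`. -/
def sumLits (l : ℕ) (σ : List Bool) (S S' : List MLO) : List MLO :=
  ((List.range l ×ˢ List.range σ.length).map fun p =>
    lit (bif σ.getD p.2 false then decide (mem p.1 p.2 ∈ S) else decide (mem p.1 p.2 ∈ S'))
      (mem p.1 p.2)) ++
  (List.range σ.length ×ˢ List.range σ.length).map fun p =>
    lit (bif σ.getD p.1 false then bif σ.getD p.2 false then decide (lt p.1 p.2 ∈ S) else true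
      else bif σ.getD p.2 false then false else decide (lt p.1 p.2 ∈ S')) (lt p.1 p.2)

/-- The members of `H` that the table `T` assigns to a pair from `S × S'`. -/
def combine (T : List (MLO × MLO × MLO)) (S S' H : List MLO) : List MLO :=
  H.filter fun χ => ∃ r ∈ T, r.1 ∈ S ∧ r.2.1 ∈ S' ∧ r.2.2 = χ

/-- The table of all triples `(φ, ψ, χ)` of characteristic formulas of depth `n` in the individual
variables `t_i` (`i < σ.length`) and the set variables `X_j` (`j < l`), where `χ` is the type of a
sum of structures of types `φ` and `ψ`. In the sum, the individual variable `t_i` has its value in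
the first structure if the `i`-th entry of `σ` is `true`, and otherwise in the second; its value in
the other structure is a dummy. -/
def sumTable : ℕ → ℕ → List Bool → List (MLO × MLO × MLO)
  | 0, l, σ => (signed (atoms σ.length l) ×ˢ signed (atoms σ.length l)).map fun p =>
      (bigAnd p.1, bigAnd p.2, bigAnd (sumLits l σ p.1 p.2))
  | n + 1, l, σ =>
      (((hintikka n (σ.length + 1) l).sublists ×ˢ (hintikka n σ.length (l + 1)).sublists) ×ˢ
        ((hintikka n (σ.length + 1) l).sublists ×ˢ (hintikka n σ.length (l + 1)).sublists)).map
      fun p => (realizes σ.length l p.1.1 p.1.2, realizes σ.length l p.2.1 p.2.2,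
        realizes σ.length l
          (combine (sumTable n l (σ ++ [true]) ++ sumTable n l (σ ++ [false])) p.1.1 p.2.1
            (hintikka n (σ.length + 1) l))
          (combine (sumTable n (l + 1) σ) p.1.2 p.2.2 (hintikka n σ.length (l + 1))))

theorem exists_mem_sumTable {n l : ℕ} {σ : List Bool} {φ ψ : MLO}
    (hφ : φ ∈ hintikka n σ.length l) (hψ : ψ ∈ hintikka n σ.length l) :
    ∃ χ, (φ, ψ, χ) ∈ sumTable n l σ := by
  cases n with
  | zero =>
    obtain ⟨S, hS, rfl⟩ := List.mem_map.1 hφ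
    obtain ⟨S', hS', rfl⟩ := List.mem_map.1 hψ
    exact ⟨_, List.mem_map.2 ⟨(S, S'), List.pair_mem_product.2 ⟨hS, hS'⟩, rfl⟩⟩
  | succ n =>
    obtain ⟨p, hp, rfl⟩ := List.mem_map.1 hφ
    obtain ⟨p', hp', rfl⟩ := List.mem_map.1 hψ
    exact ⟨_, List.mem_map.2 ⟨(p, p'), List.pair_mem_product.2 ⟨hp, hp'⟩, rfl⟩⟩

theorem mem_hintikka_of_mem_sumTable {n l : ℕ} {σ : List Bool} {r : MLO × MLO × MLO}
    (h : r ∈ sumTable n l σ) :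
    r.1 ∈ hintikka n σ.length l ∧ r.2.1 ∈ hintikka n σ.length l ∧
      r.2.2 ∈ hintikka n σ.length l := by
  cases n with
  | zero =>
    obtain ⟨p, hp, rfl⟩ := List.mem_map.1 h
    obtain ⟨h1, h2⟩ := List.mem_product.1 hp
    exact ⟨List.mem_map_of_mem h1, List.mem_map_of_mem h2, List.mem_map_of_mem
      (append_mem_signed (map_lit_mem_signed _ _ _) (map_lit_mem_signed _ _ _))⟩
  | succ n =>
    obtain ⟨p, hp, rfl⟩ := List.mem_map.1 h
    obtain ⟨h1, h2⟩ := List.mem_product.1 hp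
    exact ⟨List.mem_map.2 ⟨_, h1, rfl⟩, List.mem_map.2 ⟨_, h2, rfl⟩, mem_hintikka_succ.2
      ⟨_, _, List.filter_sublist, List.filter_sublist, rfl⟩⟩

theorem mem_combine {T : List (MLO × MLO × MLO)} {S S' H : List MLO} {χ : MLO} :
    χ ∈ combine T S S' H ↔ χ ∈ H ∧ ∃ φ ∈ S, ∃ ψ ∈ S', (φ, ψ, χ) ∈ T := by
  simp only [combine, List.mem_filter, decide_eq_true_eq]
  refine and_congr_right fun _ => ⟨?_, ?_⟩
  · rintro ⟨⟨φ, ψ, χ⟩, hr, h1, h2, rfl⟩; exact ⟨φ, h1, ψ, h2, hr⟩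
  · rintro ⟨φ, h1, ψ, h2, hr⟩; exact ⟨_, hr, h1, h2, rfl⟩

section Sum

variable {A B : Type*}

theorem inl_mem_sumSet {P : Set A} {Q : Set B} {a : A} :
    toLex (Sum.inl a) ∈ sumSet P Q ↔ a ∈ P := Iff.rfl

theorem inr_mem_sumSet {P : Set A} {Q : Set B} {b : B} :
    toLex (Sum.inr b) ∈ sumSet P Q ↔ b ∈ Q := Iff.rfl

theorem forall_lex_sum {p : A ⊕ₗ B → Prop} :
    (∀ x, p x) ↔ (∀ a, p (toLex (Sum.inl a))) ∧ ∀ b, p (toLex (Sum.inr b)) :=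
  ⟨fun h => ⟨fun _ => h _, fun _ => h _⟩, fun h x => by
    induction x using Lex.rec with | _ x => cases x; exacts [h.1 _, h.2 _]⟩

theorem sumSet_preimage (P : Set (A ⊕ₗ B)) :
    sumSet ((fun a => toLex (Sum.inl a)) ⁻¹' P) ((fun b => toLex (Sum.inr b)) ⁻¹' P) = P :=
  Set.ext (forall_lex_sum.2 ⟨fun _ => Iff.rfl, fun _ => Iff.rfl⟩)

/-- Extending the assignments of both summands by a new variable extends that of the sum; only one
of the two new values is used. -/
theorem update_sumAssign (σ : List Bool) (v : ℕ → A) (w : ℕ → B) (b : Bool) (x : A) (y : B) :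
    sumAssign (σ ++ [b]) (Function.update v σ.length x) (Function.update w σ.length y) =
      Function.update (sumAssign σ v w) σ.length
        (bif b then toLex (Sum.inl x) else toLex (Sum.inr y)) := by
  funext t
  rcases lt_trichotomy t σ.length with h | rfl | h
  · simp [sumAssign, h.ne, List.getElem?_append_left h]
  · simp [sumAssign]
  · have h1 : (σ ++ [b])[t]? = none := by simp; omega
    have h2 : σ[t]? = none := by simp; omega
    simp [sumAssign, h.ne', h1, h2]

theorem update_sumSet (V : ℕ → Set A) (W : ℕ → Set B) (l : ℕ) (P : Set A) (Q : Set B) :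
    (fun i => sumSet (Function.update V l P i) (Function.update W l Q i)) =
      Function.update (fun i => sumSet (V i) (W i)) l (sumSet P Q) := by
  funext i
  by_cases h : i = l
  · subst h; simp
  · simp [h]

variable [LinearOrder A] [LinearOrder B]

/-- The composition theorem: the entries of the sum table are correct. -/
theorem sat_of_mem_sumTable {n l : ℕ} {σ : List Bool} {φ ψ χ : MLO}
    (h : (φ, ψ, χ) ∈ sumTable n l σ) {v : ℕ → A} {V : ℕ → Set A} {w : ℕ → B} {W : ℕ → Set B}
    (hφ : Sat v V φ) (hψ : Sat w W ψ) :
    Sat (sumAssign σ v w) (fun i => sumSet (V i) (W i)) χ := by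
  induction n generalizing l σ φ ψ χ v V w W with
  | zero =>
    obtain ⟨⟨S, S'⟩, hp, he⟩ := List.mem_map.1 h
    obtain ⟨hS, hS'⟩ := List.mem_product.1 hp
    simp only [Prod.mk.injEq] at he
    obtain ⟨rfl, rfl, rfl⟩ := he
    have hm := fun φ hφ' => mem_iff_sat_of_mem_signed (φ := φ) hS hφ hφ'
    have hm' := fun φ hφ' => mem_iff_sat_of_mem_signed (φ := φ) hS' hψ hφ'
    rw [sat_bigAnd]
    intro φ hφ
    rcases List.mem_append.1 hφ with hφ | hφ <;> obtain ⟨⟨i, t⟩, hit, rfl⟩ := List.mem_map.1 hφ <;>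
      simp only [List.mem_product, List.mem_range] at hit
    · have ha : mem i t ∈ atoms σ.length l := mem_atoms.2 (.inl ⟨i, t, hit.1, hit.2, rfl⟩)
      rw [sat_lit]
      cases ht : σ.getD t false <;> rw [List.getD_eq_getElem?_getD] at ht
      · simp [Sat, sumAssign, ht, hm' _ ha, inr_mem_sumSet]
      · simp [Sat, sumAssign, ht, hm _ ha, inl_mem_sumSet]
    · have ha : lt i t ∈ atoms σ.length l := mem_atoms.2 (.inr ⟨i, t, hit.1, hit.2, rfl⟩)
      rw [sat_lit]
      cases hi : σ.getD i false <;> cases ht : σ.getD t false <;>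
        rw [List.getD_eq_getElem?_getD] at hi ht <;>
        simp [Sat, sumAssign, hi, ht, hm _ ha, hm' _ ha]
  | succ n ih =>
    obtain ⟨⟨⟨S, T⟩, S', T'⟩, hp, he⟩ := List.mem_map.1 h
    simp only [List.mem_product, List.mem_sublists] at hp
    obtain ⟨⟨hS, hT⟩, hS', hT'⟩ := hp
    simp only [Prod.mk.injEq] at he
    obtain ⟨rfl, rfl, rfl⟩ := he
    rw [sat_realizes] at hφ hψ ⊢
    obtain ⟨⟨hS1, hS2⟩, hT1, hT2⟩ := hφ
    obtain ⟨⟨hS1', hS2'⟩, hT1', hT2'⟩ := hψ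
    simp only [mem_combine, List.mem_append]
    refine ⟨⟨?_, ?_⟩, ?_, ?_⟩
    · rintro χ ⟨-, φ, hφ, ψ, hψ, hr | hr⟩ <;> obtain ⟨a, ha⟩ := hS1 φ hφ <;>
        obtain ⟨b, hb⟩ := hS1' ψ hψ <;> have := ih hr ha hb <;> rw [update_sumAssign] at this <;>
        exact ⟨_, this⟩
    · -- The value of the new variable in the other summand is a dummy, so any value will do.
      rw [forall_lex_sum]
      constructor
      · intro a
        obtain ⟨φ, hφ, ha⟩ := hS2 a
        obtain ⟨ψ, hψ, hb⟩ := hS2' (w 0)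
        obtain ⟨χ, hχ⟩ := exists_mem_sumTable (σ := σ ++ [true]) (by simpa using hS.subset hφ)
          (by simpa using hS'.subset hψ)
        have := ih hχ ha hb
        rw [update_sumAssign] at this
        exact ⟨χ, ⟨by simpa using (mem_hintikka_of_mem_sumTable hχ).2.2, φ, hφ, ψ, hψ, .inl hχ⟩,
          this⟩
      · intro b
        obtain ⟨φ, hφ, ha⟩ := hS2 (v 0)
        obtain ⟨ψ, hψ, hb⟩ := hS2' b
        obtain ⟨χ, hχ⟩ := exists_mem_sumTable (σ := σ ++ [false]) (by simpa using hS.subset hφ)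
          (by simpa using hS'.subset hψ)
        have := ih hχ ha hb
        rw [update_sumAssign] at this
        exact ⟨χ, ⟨by simpa using (mem_hintikka_of_mem_sumTable hχ).2.2, φ, hφ, ψ, hψ, .inr hχ⟩,
          this⟩
    · rintro χ ⟨-, φ, hφ, ψ, hψ, hr⟩
      obtain ⟨P, hP⟩ := hT1 φ hφ
      obtain ⟨Q, hQ⟩ := hT1' ψ hψ
      have := ih hr hP hQ
      rw [update_sumSet] at this
      exact ⟨_, this⟩
    · intro P
      rw [← sumSet_preimage P]
      obtain ⟨φ, hφ, hP⟩ := hT2 ((fun a => toLex (Sum.inl a)) ⁻¹' P)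
      obtain ⟨ψ, hψ, hQ⟩ := hT2' ((fun b => toLex (Sum.inr b)) ⁻¹' P)
      obtain ⟨χ, hχ⟩ := exists_mem_sumTable (hT.subset hφ) (hT'.subset hψ)
      have := ih hχ hP hQ
      rw [update_sumSet] at this
      exact ⟨χ, ⟨(mem_hintikka_of_mem_sumTable hχ).2.2, φ, hφ, ψ, hψ, hχ⟩, this⟩

end Sum

/-! ### Types of chains with two subsets -/

theorem IsBinary.models_iff {A : Type*} [LinearOrder A] {φ : MLO} (h : φ.IsBinary) {P Q : Set A}
    (v : ℕ → A) : Models φ P Q ↔ Sat v (assign P Q) φ :=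
  ⟨fun H => H v, fun H w => (sat_congr φ (by simp [h.1]) fun _ _ => rfl).2 H⟩

theorem assign_sumSet {A B : Type*} (P₀ Q₀ : Set A) (P₁ Q₁ : Set B) :
    (fun i => sumSet (assign P₀ Q₀ i) (assign P₁ Q₁ i)) =
      assign (sumSet P₀ P₁) (sumSet Q₀ Q₁) := by
  funext i
  rcases i with _ | _ | i
  · rfl
  · rfl
  · exact Set.ext (forall_lex_sum.2 ⟨fun _ => Iff.rfl, fun _ => Iff.rfl⟩)

section Chain

variable {A : Type*} [LinearOrder A] [Nonempty A] {φ : MLO} {P Q : Set A} {n : ℕ}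

theorem IsBinary.models_neg (h : φ.IsBinary) : Models (neg φ) P Q ↔ ¬ Models φ P Q := by
  inhabit A
  rw [h.models_iff fun _ => default]
  exact IsBinary.models_iff (φ := neg φ) h _

theorem IsBinary.models_image {B : Type*} [LinearOrder B] (h : φ.IsBinary) (e : A ≃o B) :
    Models φ (e '' P) (e '' Q) ↔ Models φ P Q := by
  inhabit A
  have : Nonempty B := ⟨e default⟩
  rw [h.models_iff (e ∘ fun _ => default), h.models_iff fun _ => default, ← sat_orderIso e]
  have : (assign (e '' P) (e '' Q)) = fun i => e '' assign P Q i := by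
    funext i; rcases i with _ | _ | i <;> simp [assign]
  rw [this]

theorem isBinary_of_mem_Char2 (h : φ ∈ Char2 n) : φ.IsBinary := by
  obtain ⟨h1, h2⟩ := free_hintikka (List.mem_toFinset.1 h)
  exact ⟨by simpa using h1, h2.trans (by decide)⟩

theorem isBinary_disj {G : Finset MLO} (hG : G ⊆ Char2 n) : (disj G).IsBinary := by
  have h : ∀ φ ∈ G.toList, φ.IsBinary := fun φ hφ =>
    isBinary_of_mem_Char2 (hG (Finset.mem_toList.1 hφ))
  exact ⟨Finset.subset_empty.1 (freeInd_bigOr fun φ hφ => (h φ hφ).1.subset),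
    freeSet_bigOr fun φ hφ => (h φ hφ).2⟩

theorem models_disj {G : Finset MLO} (hG : G ⊆ Char2 n) :
    Models (disj G) P Q ↔ ∃ τ ∈ G, Models τ P Q := by
  inhabit A
  rw [(isBinary_disj hG).models_iff fun _ => default, disj, sat_bigOr]
  simp only [Finset.mem_toList]
  exact exists_congr fun τ => and_congr_right fun h =>
    ((isBinary_of_mem_Char2 (hG h)).models_iff _).symm

theorem exists_type (n : ℕ) (P Q : Set A) : ∃ τ ∈ Char2 n, Models τ P Q := by
  inhabit A
  obtain ⟨τ, ⟨h1, h2⟩, -⟩ := existsUnique_hintikka n 0 2 (fun _ => default) (assign P Q)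
  have h : τ ∈ Char2 n := List.mem_toFinset.2 h1
  exact ⟨τ, h, ((isBinary_of_mem_Char2 h).models_iff _).2 h2⟩

theorem type_unique {τ τ' : MLO} (h : τ ∈ Char2 n) (h' : τ' ∈ Char2 n) (hm : Models τ P Q)
    (hm' : Models τ' P Q) : τ = τ' := by
  inhabit A
  exact (existsUnique_hintikka n 0 2 (fun _ => default) (assign P Q)).unique
    ⟨List.mem_toFinset.1 h, hm _⟩ ⟨List.mem_toFinset.1 h', hm' _⟩

/-- Membership of the type in `G` decides the winning condition given by `G`. -/
theorem models_disj_iff_mem {G : Finset MLO} (hG : G ⊆ Char2 n) {τ : MLO} (h : τ ∈ Char2 n)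
    (hm : Models τ P Q) : Models (disj G) P Q ↔ τ ∈ G := by
  rw [models_disj hG]
  exact ⟨fun ⟨τ', h', hm'⟩ => type_unique h (hG h') hm hm' ▸ h', fun h' => ⟨τ, h', hm⟩⟩

/-- Every formula `φ(X_0, X_1)` is, over chains, equivalent to a disjunction of characteristic
formulas. -/
theorem IsBinary.exists_equiv_disj.{w} (h : φ.IsBinary) : ∃ n, ∃ G ⊆ Char2 n,
    ∀ (A : Type w) [LinearOrder A] [Nonempty A] (P Q : Set A),
      Models φ P Q ↔ Models (disj G) P Q := by
  classical
  let G := (Char2 φ.depth).filter fun τ => ∃ (A : Type w) (_ : LinearOrder A) (_ : Nonempty A)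
    (P Q : Set A), Models τ P Q ∧ Models φ P Q
  have hG : G ⊆ Char2 φ.depth := Finset.filter_subset _ _
  refine ⟨φ.depth, G, hG, fun A _ _ P Q => ?_⟩
  obtain ⟨τ, hτ, hm⟩ := exists_type φ.depth P Q
  rw [models_disj_iff_mem hG hτ hm, Finset.mem_filter]
  refine ⟨fun hφ => ⟨hτ, A, _, ‹_›, P, Q, hm, hφ⟩, ?_⟩
  rintro ⟨-, B, _, _, P', Q', hm', hφ⟩ v
  inhabit B
  have hw := hφ fun _ => default
  refine (sat_iff_of_sat_hintikka (List.mem_toFinset.1 hτ) (hm v) (hm' fun _ => default) φ le_rfl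
    (by simp [h.1]) fun t ht => ⟨t, ?_, rfl, rfl⟩).2 hw
  have := h.2 ht
  simp at this; omega

end Chain

theorem isTypeSum_of_mem_sumTable.{w} {n : ℕ} {φ ψ χ : MLO} (h : (φ, ψ, χ) ∈ sumTable n 2 []) :
    IsTypeSum.{w} n φ ψ χ := by
  obtain ⟨-, -, hχ⟩ := mem_hintikka_of_mem_sumTable h
  have hχ' : χ ∈ Char2 n := List.mem_toFinset.2 hχ
  refine ⟨hχ', fun A B _ _ _ _ P₀ Q₀ P₁ Q₁ h₀ h₁ => ?_⟩
  inhabit A; inhabit B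
  have := sat_of_mem_sumTable h (h₀ fun _ => default) (h₁ fun _ => default)
  rw [assign_sumSet] at this
  exact ((isBinary_of_mem_Char2 hχ').models_iff _).2 this

theorem exists_isTypeSum.{w} {n : ℕ} {φ ψ : MLO} (hφ : φ ∈ Char2 n) (hψ : ψ ∈ Char2 n) :
    ∃ χ, IsTypeSum.{w} n φ ψ χ :=
  (exists_mem_sumTable (σ := []) (List.mem_toFinset.1 hφ) (List.mem_toFinset.1 hψ)).imp
    fun _ => isTypeSum_of_mem_sumTable

theorem isTypeSum_typeSum.{w} {n : ℕ} {φ ψ : MLO} (hφ : φ ∈ Char2 n) (hψ : ψ ∈ Char2 n) :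
    IsTypeSum.{w} n φ ψ (typeSum.{w} n φ ψ) :=
  @Classical.epsilon_spec _ (IsTypeSum.{w} n φ ψ) (exists_isTypeSum hφ hψ)

end MLO

/-! ### Games on linear orders -/

section Games

variable {A B : Type*} [LinearOrder A] [LinearOrder B]

/-- Causality, expressed by the single rounds. -/
theorem causal_iff {f : Set A → Set A} :
    Causal f ↔ ∀ P P' b, (∀ x ≤ b, x ∈ P ↔ x ∈ P') → (b ∈ f P ↔ b ∈ f P') := by
  have hI : ∀ (P P' : Set A) b, P ∩ Set.Iic b = P' ∩ Set.Iic b ↔ ∀ x ≤ b, x ∈ P ↔ x ∈ P' := by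
    intro P P' b; simp [Set.ext_iff]
  simp only [Causal, hI]
  exact ⟨fun h P P' b hb => h P P' b hb b le_rfl, fun h P P' b hb x hx =>
    h P P' x fun y hy => hb y (hy.trans hx)⟩

/-- Strong causality, expressed by the single rounds. -/
theorem stronglyCausal_iff {f : Set A → Set A} :
    StronglyCausal f ↔ ∀ P P' b, (∀ x < b, x ∈ P ↔ x ∈ P') → (b ∈ f P ↔ b ∈ f P') := by
  have hI : ∀ (P P' : Set A) b, P ∩ Set.Iic b = P' ∩ Set.Iic b ↔ ∀ x ≤ b, x ∈ P ↔ x ∈ P' := by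
    intro P P' b; simp [Set.ext_iff]
  have hI' : ∀ (P P' : Set A) b, P ∩ Set.Iio b = P' ∩ Set.Iio b ↔ ∀ x < b, x ∈ P ↔ x ∈ P' := by
    intro P P' b; simp [Set.ext_iff]
  simp only [StronglyCausal, hI, hI']
  exact ⟨fun h P P' b hb => h P P' b hb b le_rfl, fun h P P' b hb x hx =>
    h P P' x fun y hy => hb y (hy.trans_le hx)⟩

/-- Player I has a winning strategy in the game on `A` in which she has to achieve `R P Q`. The
rounds are the elements of `A`, which may be any linear order. -/
def IWins (A : Type*) [LinearOrder A] (R : Set A → Set A → Prop) : Prop :=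
  ∃ f : Set A → Set A, StronglyCausal f ∧ ∀ Q, R (f Q) Q

/-- Player II has a winning strategy in the game on `A` in which he has to prevent `R P Q`. -/
def IIWins (A : Type*) [LinearOrder A] (R : Set A → Set A → Prop) : Prop :=
  ∃ f : Set A → Set A, Causal f ∧ ∀ P, ¬ R P (f P)

theorem IWins.mono {R R' : Set A → Set A → Prop} (h : IWins A R) (hR : ∀ P Q, R P Q → R' P Q) :
    IWins A R' :=
  h.imp fun _ hf => ⟨hf.1, fun _ => hR _ _ (hf.2 _)⟩

theorem IIWins.mono {R R' : Set A → Set A → Prop} (h : IIWins A R) (hR : ∀ P Q, R' P Q → R P Q) :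
    IIWins A R' :=
  h.imp fun _ hf => ⟨hf.1, fun _ hP => hf.2 _ (hR _ _ hP)⟩

theorem IWins.of_orderIso {R : Set B → Set B → Prop} (e : A ≃o B)
    (h : IWins A fun P Q => R (e '' P) (e '' Q)) : IWins B R := by
  obtain ⟨f, hf, hw⟩ := h
  refine ⟨fun Q => e '' f (e ⁻¹' Q), ?_, fun Q => ?_⟩
  · rw [stronglyCausal_iff] at hf ⊢
    intro P P' b hb
    obtain ⟨a, rfl⟩ := e.surjective b
    simpa using hf (e ⁻¹' P) (e ⁻¹' P') a fun x hx => hb (e x) (by simpa using hx)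
  · simpa [Set.image_preimage_eq _ e.surjective] using hw (e ⁻¹' Q)

theorem IIWins.of_orderIso {R : Set B → Set B → Prop} (e : A ≃o B)
    (h : IIWins A fun P Q => R (e '' P) (e '' Q)) : IIWins B R := by
  obtain ⟨f, hf, hw⟩ := h
  refine ⟨fun Q => e '' f (e ⁻¹' Q), ?_, fun Q => ?_⟩
  · rw [causal_iff] at hf ⊢
    intro P P' b hb
    obtain ⟨a, rfl⟩ := e.surjective b
    simpa using hf (e ⁻¹' P) (e ⁻¹' P') a fun x hx => hb (e x) (by simpa using hx)
  · simpa [Set.image_preimage_eq _ e.surjective] using hw (e ⁻¹' Q)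

open MLO

/-- Player I wins on `A + B` if on `A` she can reach a position from which she wins on `B`. -/
theorem IWins.sum {R : Set (A ⊕ₗ B) → Set (A ⊕ₗ B) → Prop}
    (h : IWins A fun P Q => IWins B fun P' Q' => R (sumSet P P') (sumSet Q Q')) :
    IWins (A ⊕ₗ B) R := by
  obtain ⟨f, hf, hw⟩ := h
  choose g hg hgw using hw
  rw [stronglyCausal_iff] at hf
  simp only [stronglyCausal_iff] at hg
  refine ⟨fun Q => sumSet (f ((fun a => toLex (Sum.inl a)) ⁻¹' Q))
    (g ((fun a => toLex (Sum.inl a)) ⁻¹' Q) ((fun b => toLex (Sum.inr b)) ⁻¹' Q)), ?_, fun Q => ?_⟩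
  · rw [stronglyCausal_iff]
    intro P P'
    rw [forall_lex_sum]
    constructor
    · intro a ha
      exact hf _ _ a fun x hx => ha _ (by simpa using hx)
    · intro b hb
      have : (fun a => toLex (Sum.inl a)) ⁻¹' P = (fun a => toLex (Sum.inl a)) ⁻¹' P' :=
        Set.ext fun a => hb _ (Sum.Lex.inl_lt_inr _ _)
      rw [inr_mem_sumSet, inr_mem_sumSet, this]
      exact hg _ _ _ b fun x hx => hb _ (by simpa using hx)
  · have := hgw ((fun a => toLex (Sum.inl a)) ⁻¹' Q) ((fun b => toLex (Sum.inr b)) ⁻¹' Q)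
    beta_reduce at this
    rwa [sumSet_preimage] at this

/-- Player II wins on `A + B` if on `A` he can reach a position from which he wins on `B`. -/
theorem IIWins.sum {R : Set (A ⊕ₗ B) → Set (A ⊕ₗ B) → Prop}
    (h : IIWins A fun P Q => ¬ IIWins B fun P' Q' => R (sumSet P P') (sumSet Q Q')) :
    IIWins (A ⊕ₗ B) R := by
  obtain ⟨f, hf, hw⟩ := h
  simp only [not_not] at hw
  choose g hg hgw using hw
  rw [causal_iff] at hf
  simp only [causal_iff] at hg
  refine ⟨fun Q => sumSet (f ((fun a => toLex (Sum.inl a)) ⁻¹' Q))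
    (g ((fun a => toLex (Sum.inl a)) ⁻¹' Q) ((fun b => toLex (Sum.inr b)) ⁻¹' Q)), ?_, fun Q => ?_⟩
  · rw [causal_iff]
    intro P P'
    rw [forall_lex_sum]
    constructor
    · intro a ha
      exact hf _ _ a fun x hx => ha _ (by simpa using hx)
    · intro b hb
      have : (fun a => toLex (Sum.inl a)) ⁻¹' P = (fun a => toLex (Sum.inl a)) ⁻¹' P' :=
        Set.ext fun a => hb _ (Sum.Lex.inl_le_inr _ _)
      rw [inr_mem_sumSet, inr_mem_sumSet, this]
      exact hg _ _ _ b fun x hx => hb _ (by simpa using hx)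
  · have := hgw ((fun a => toLex (Sum.inl a)) ⁻¹' Q) ((fun b => toLex (Sum.inr b)) ⁻¹' Q)
    beta_reduce at this
    rwa [sumSet_preimage] at this

/-- On a well-order the two players cannot both have winning strategies: by well-founded recursion
there is a play that is consistent with both. -/
theorem IWins.not_iiWins [WellFoundedLT A] {R : Set A → Set A → Prop} (h : IWins A R) :
    ¬ IIWins A R := by
  rintro ⟨g, hg, hgw⟩
  obtain ⟨f, hf, hfw⟩ := h
  rw [stronglyCausal_iff] at hf
  rw [causal_iff] at hg
  -- `p b` is the decision of Player I in round `b`, given her decisions in the earlier rounds.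
  let p : A → Prop := (wellFounded_lt (α := A)).fix fun b ih => b ∈ f (g {x | ∃ h : x < b, ih x h})
  have hp : ∀ b, p b ↔ b ∈ f (g {x | x < b ∧ p x}) := by
    intro b
    conv_lhs => simp only [p]
    rw [WellFounded.fix_eq]
    simp [p]
  have hfix : f (g {x | p x}) = {x | p x} := by
    ext b
    rw [Set.mem_ofPred_eq, hp b]
    refine hf _ _ b fun x hx => hg _ _ x fun y hy => ?_
    simp [hy.trans_lt hx]
  have := hfw (g {x | p x})
  rw [hfix] at this
  exact hgw _ this

end Games

/-! ### The composition theorem for games -/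

open MLO

theorem playerIIWins_iff {α : Ordinal} {φ : MLO} (hα : 0 < α) (h : φ.IsBinary) :
    PlayerIIWins α φ ↔ IIWins α.ToType (Models φ) := by
  have : Nonempty α.ToType := Ordinal.nonempty_toType_iff.2 hα.ne'
  simp [PlayerIIWins, IIWins, h.models_neg]

theorem exists_orderIso_toType_add.{w} (α β : Ordinal.{w}) :
    Nonempty (α.ToType ⊕ₗ β.ToType ≃o (α + β).ToType) := by
  have h : Ordinal.type (Sum.Lex (· < ·) (· < ·) : α.ToType ⊕ β.ToType → _ → Prop) =
      Ordinal.type ((· < ·) : (α + β).ToType → _ → Prop) := by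
    rw [Ordinal.type_sum_lex, Ordinal.type_toType, Ordinal.type_toType, Ordinal.type_toType]
  obtain ⟨e⟩ := Ordinal.type_eq.1 h
  exact ⟨OrderIso.ofRelIsoLT ⟨ofLex.trans e.toEquiv, e.map_rel_iff⟩⟩

section Add

universe w

variable {α β : Ordinal.{w}} {n : ℕ} {S : MLO → MLO → MLO → Prop}

/-- A relation on characteristic formulas of depth `n` is a version of the sum of types if it
assigns to any two of them some sum of theirs. -/
structure IsSumRel (n : ℕ) (S : MLO → MLO → MLO → Prop) : Prop where
  isTypeSum : ∀ τ ∈ Char2 n, ∀ τ' ∈ Char2 n, ∀ χ, S τ τ' χ → IsTypeSum.{w} n τ τ' χ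
  exists_sum : ∀ τ ∈ Char2 n, ∀ τ' ∈ Char2 n, ∃ χ, S τ τ' χ

/-- Whether a sum satisfies the winning condition `G` can be read off from `S` and the types of the
summands. -/
theorem IsSumRel.models_disj_iff (hS : IsSumRel.{w} n S) {A B : Type w} [LinearOrder A]
    [LinearOrder B] [Nonempty A] [Nonempty B] {P₀ Q₀ : Set A} {P₁ Q₁ : Set B} {τ τ' : MLO}
    (hτ : τ ∈ Char2 n) (hτ' : τ' ∈ Char2 n) (h : Models τ P₀ Q₀) (h' : Models τ' P₁ Q₁)
    {G : Finset MLO} (hG : G ⊆ Char2 n) :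
    Models (disj G) (sumSet P₀ P₁) (sumSet Q₀ Q₁) ↔ ∃ χ ∈ G, S τ τ' χ := by
  inhabit A
  have : Nonempty (A ⊕ₗ B) := ⟨toLex (Sum.inl default)⟩
  rw [models_disj hG]
  constructor
  · rintro ⟨χ, hχ, hm⟩
    obtain ⟨χ', h2⟩ := hS.exists_sum τ hτ τ' hτ'
    obtain ⟨h3, h4⟩ := hS.isTypeSum _ hτ _ hτ' _ h2
    have := type_unique (hG hχ) h3 hm (h4 _ _ _ _ _ _ h h')
    exact ⟨χ, hχ, this ▸ h2⟩
  · rintro ⟨χ, hχ, h2⟩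
    exact ⟨χ, hχ, (hS.isTypeSum _ hτ _ hτ' _ h2).2 _ _ _ _ _ _ h h'⟩

open Classical in
/-- The set `K(C, G)` formed with respect to the version `S` of the sum of types. -/
noncomputable def kRel (n : ℕ) (S : MLO → MLO → MLO → Prop) (C : Finset (Finset MLO))
    (G : Finset MLO) : Finset MLO :=
  (Char2 n).filter fun τ => ∃ G' ∈ C, ∀ τ' ∈ G', ∃ χ ∈ G, S τ τ' χ

theorem mem_kRel {C : Finset (Finset MLO)} {G : Finset MLO} {τ : MLO} :
    τ ∈ kRel n S C G ↔ τ ∈ Char2 n ∧ ∃ G' ∈ C, ∀ τ' ∈ G', ∃ χ ∈ G, S τ τ' χ := by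
  simp [kRel]

theorem kRel_subset {C : Finset (Finset MLO)} {G : Finset MLO} : kRel n S C G ⊆ Char2 n :=
  fun _ h => (mem_kRel.1 h).1

theorem mem_gameType {G : Finset MLO} :
    G ∈ gameType n α ↔ G ⊆ Char2 n ∧ PlayerIWins α (disj G) := by
  simp [gameType]

/-- Player I first plays for a type in `K(C, G)` and then, depending on the type reached, for some
`G' ∈ C`. -/
theorem playerIWins_add (hS : IsSumRel.{w} n S) (hα : 0 < α) (hβ : 0 < β) {G : Finset MLO}
    (hG : G ⊆ Char2 n) (h : PlayerIWins α (disj (kRel n S (gameType n β) G))) :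
    PlayerIWins (α + β) (disj G) := by
  have : Nonempty α.ToType := Ordinal.nonempty_toType_iff.2 hα.ne'
  have : Nonempty β.ToType := Ordinal.nonempty_toType_iff.2 hβ.ne'
  have : Nonempty (α.ToType ⊕ₗ β.ToType) := ⟨toLex (Sum.inl (Classical.arbitrary _))⟩
  obtain ⟨e⟩ := exists_orderIso_toType_add α β
  refine IWins.of_orderIso (R := Models (disj G)) e ?_
  simp only [(isBinary_disj hG).models_image]
  refine IWins.sum (IWins.mono (show IWins _ _ from h) fun P Q hPQ => ?_)
  obtain ⟨τ, hτ, hm⟩ := (models_disj kRel_subset).1 hPQ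
  obtain ⟨hτ, G', hG', hsum⟩ := mem_kRel.1 hτ
  obtain ⟨hG'n, hw⟩ := mem_gameType.1 hG'
  refine IWins.mono (show IWins _ _ from hw) fun P' Q' h' => ?_
  obtain ⟨τ', hτ', hm'⟩ := (models_disj hG'n).1 h'
  exact (hS.models_disj_iff hτ (hG'n hτ') hm hm' hG).2 (hsum τ' hτ')

/-- Player II first avoids `K(C, G)`. If a type `τ` is reached, then Player I does not win the
second game for `{τ' | τ + τ' ∈ G}`, as this set would otherwise be a member of `C` that puts `τ`
into `K(C, G)`. So Player II can avoid this set. -/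
theorem playerIIWins_add (hS : IsSumRel.{w} n S) (hα : Determinate α) (hβ : Determinate β)
    {G : Finset MLO} (hG : G ⊆ Char2 n)
    (h : ¬ PlayerIWins α (disj (kRel n S (gameType n β) G))) :
    PlayerIIWins (α + β) (disj G) := by
  classical
  have : Nonempty α.ToType := Ordinal.nonempty_toType_iff.2 hα.1.ne'
  have : Nonempty β.ToType := Ordinal.nonempty_toType_iff.2 hβ.1.ne'
  have : Nonempty (α.ToType ⊕ₗ β.ToType) := ⟨toLex (Sum.inl (Classical.arbitrary _))⟩
  have h' := (hα.2 _ (isBinary_disj kRel_subset)).resolve_left h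
  rw [playerIIWins_iff hα.1 (isBinary_disj kRel_subset)] at h'
  rw [playerIIWins_iff (hα.1.trans_le le_self_add) (isBinary_disj hG)]
  obtain ⟨e⟩ := exists_orderIso_toType_add α β
  refine IIWins.of_orderIso (R := Models (disj G)) e ?_
  simp only [(isBinary_disj hG).models_image]
  refine IIWins.sum (h'.mono fun P Q => ?_)
  contrapose!
  intro hPQ
  obtain ⟨τ, hτ, hm⟩ := exists_type n P Q
  rw [models_disj_iff_mem kRel_subset hτ hm] at hPQ
  let G' := (Char2 n).filter fun τ' => ∃ χ ∈ G, S τ τ' χ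
  have hG' : G' ⊆ Char2 n := Finset.filter_subset _ _
  have hn : ¬ PlayerIWins β (disj G') := fun hw => hPQ <| mem_kRel.2
    ⟨hτ, G', mem_gameType.2 ⟨hG', hw⟩, fun τ' hτ' => (Finset.mem_filter.1 hτ').2⟩
  have hw := (hβ.2 _ (isBinary_disj hG')).resolve_left hn
  rw [playerIIWins_iff hβ.1 (isBinary_disj hG')] at hw
  refine hw.mono fun P' Q' hm' => ?_
  obtain ⟨τ', hτ', hm''⟩ := exists_type n P' Q'
  rw [hS.models_disj_iff hτ hτ' hm hm'' hG] at hm'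
  exact (models_disj_iff_mem hG' hτ' hm'').2 (Finset.mem_filter.2 ⟨hτ', hm'⟩)

theorem mem_gameType_add_iff (hS : IsSumRel.{w} n S) (hα : Determinate α) (hβ : Determinate β)
    {G : Finset MLO} (hG : G ⊆ Char2 n) :
    G ∈ gameType n (α + β) ↔ kRel n S (gameType n β) G ∈ gameType n α := by
  simp only [mem_gameType, hG, kRel_subset, true_and]
  refine ⟨fun h => ?_, playerIWins_add hS hα.1 hβ.1 hG⟩
  by_contra hn
  have h' := playerIIWins_add hS hα hβ hG hn
  rw [playerIIWins_iff (hα.1.trans_le le_self_add) (isBinary_disj hG)] at h'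
  exact IWins.not_iiWins (show IWins _ _ from h) h'

theorem isSumRel_typeSum (n : ℕ) : IsSumRel.{w} n fun τ τ' χ => χ = typeSum.{w} n τ τ' where
  isTypeSum _ hτ _ hτ' _ h := h ▸ isTypeSum_typeSum hτ hτ'
  exists_sum _ _ _ _ := ⟨_, rfl⟩

/-- The sum table need not be the graph of `typeSum` on types that no chain realizes, but it is a
version of the sum of types. -/
theorem isSumRel_sumTable (n : ℕ) : IsSumRel.{w} n fun τ τ' χ => (τ, τ', χ) ∈ sumTable n 2 [] where
  isTypeSum _ _ _ _ _ h := isTypeSum_of_mem_sumTable h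
  exists_sum _ hτ _ hτ' := exists_mem_sumTable (σ := []) (List.mem_toFinset.1 hτ)
    (List.mem_toFinset.1 hτ')

theorem kUnion_eq_kRel (C : Finset (Finset MLO)) (G : Finset MLO) :
    kUnion.{w} n C G = kRel n (fun τ τ' χ => χ = typeSum.{w} n τ τ') C G := by
  ext τ
  simp only [kUnion, kSet, mem_kRel, Finset.mem_biUnion, Finset.mem_filter]
  grind

theorem determinate_add (hα : Determinate α) (hβ : Determinate β) : Determinate (α + β) := by
  have h0 : 0 < α + β := hα.1.trans_le le_self_add
  have : Nonempty (α + β).ToType := Ordinal.nonempty_toType_iff.2 h0.ne'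
  refine ⟨h0, fun φ hφ => ?_⟩
  obtain ⟨n, G, hG, he⟩ := hφ.exists_equiv_disj.{w}
  by_cases h : PlayerIWins α
      (disj (kRel n (fun τ τ' χ => χ = typeSum.{w} n τ τ') (gameType n β) G))
  · exact .inl (IWins.mono (show IWins _ _ from playerIWins_add (isSumRel_typeSum n) hα.1 hβ.1 hG h)
      fun P Q => (he _ P Q).2)
  · have := playerIIWins_add (isSumRel_typeSum n) hα hβ hG h
    rw [playerIIWins_iff h0 (isBinary_disj hG)] at this
    rw [playerIIWins_iff h0 hφ]
    exact .inr (this.mono fun P Q => (he _ P Q).1)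

end Add

/-! ### Formulas are primitive recursively coded -/

namespace MLO

/-- The recursive characterization of the numbers that are codes of formulas. -/
theorem mem_range_code_iff {n : ℕ} : n ∈ Set.range code ↔
    if n.unpair.1 = 0 then n.unpair.2 = 0
    else if n.unpair.1 < 3 then True
    else if n.unpair.1 = 3 then n.unpair.2 ∈ Set.range code
    else if n.unpair.1 < 7 then
      n.unpair.2.unpair.1 ∈ Set.range code ∧ n.unpair.2.unpair.2 ∈ Set.range code
    else if n.unpair.1 < 11 then n.unpair.2.unpair.2 ∈ Set.range code
    else False := by
  constructor
  · rintro ⟨φ, rfl⟩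
    cases φ <;> simp [code]
  · obtain ⟨⟨t, m⟩, rfl⟩ : ∃ p : ℕ × ℕ, n = Nat.pair p.1 p.2 := ⟨n.unpair, by simp⟩
    obtain ⟨⟨i, j⟩, rfl⟩ : ∃ p : ℕ × ℕ, m = Nat.pair p.1 p.2 := ⟨m.unpair, by simp⟩
    simp only [Nat.unpair_pair]
    split_ifs with h0 h1 h2 h3 h4
    · rintro h; exact ⟨fls, by simp [code, h, h0]⟩
    · rintro -
      obtain rfl | rfl : t = 1 ∨ t = 2 := by omega
      · exact ⟨mem i j, rfl⟩
      · exact ⟨lt i j, rfl⟩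
    · rintro ⟨φ, hφ⟩; exact ⟨neg φ, by simp [code, hφ, h2]⟩
    · rintro ⟨⟨φ, hφ⟩, ψ, hψ⟩
      obtain rfl | rfl | rfl : t = 4 ∨ t = 5 ∨ t = 6 := by omega
      · exact ⟨or φ ψ, by simp [code, hφ, hψ]⟩
      · exact ⟨and φ ψ, by simp [code, hφ, hψ]⟩
      · exact ⟨imp φ ψ, by simp [code, hφ, hψ]⟩
    · rintro ⟨φ, hφ⟩
      obtain rfl | rfl | rfl | rfl : t = 7 ∨ t = 8 ∨ t = 9 ∨ t = 10 := by omega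
      · exact ⟨ex i φ, by simp [code, hφ]⟩
      · exact ⟨all i φ, by simp [code, hφ]⟩
      · exact ⟨exSet i φ, by simp [code, hφ]⟩
      · exact ⟨allSet i φ, by simp [code, hφ]⟩
    · exact False.elim

open Primrec in
/-- Being a code is decided by course-of-values recursion along `mem_range_code_iff`; the recursive
calls are made for the three numbers that can be the code of an immediate subformula. -/
theorem primrecPred_mem_range_code : PrimrecPred fun n => n ∈ Set.range code := by
  classical
  have ht : Primrec fun n : ℕ => n.unpair.1 := fst.comp unpair
  have hm : Primrec fun n : ℕ => n.unpair.2 := snd.comp unpair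
  refine Primrec.primrecPred (nat_omega_rec' (fun n => decide (n ∈ Set.range code)) (m := id)
    (l := fun n => if n.unpair.1 < 3 then [] else
      [n.unpair.2, n.unpair.2.unpair.1, n.unpair.2.unpair.2])
    (g := fun n bs => some <|
      if n.unpair.1 = 0 then decide (n.unpair.2 = 0)
      else if n.unpair.1 < 3 then true
      else if n.unpair.1 = 3 then bs.getD 0 false
      else if n.unpair.1 < 7 then bs.getD 1 false && bs.getD 2 false
      else if n.unpair.1 < 11 then bs.getD 2 false
      else false) Primrec.id ?_ ?_ ?_ ?_)
  · refine ite (nat_lt.comp ht (const 3)) (const []) ?_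
    exact list_cons.comp hm (list_cons.comp (ht.comp hm) (list_cons.comp (hm.comp hm) (const [])))
  · refine option_some.comp ?_
    have ht' : Primrec fun p : ℕ × List Bool => p.1.unpair.1 := ht.comp fst
    have hb : ∀ i, Primrec fun p : ℕ × List Bool => p.2.getD i false := fun i =>
      (list_getD false).comp snd (const i)
    refine ite (Primrec.eq.comp ht' (const 0))
      ((Primrec.eq.comp (hm.comp fst) (const 0)).decide) ?_
    refine ite (nat_lt.comp ht' (const 3)) (const true) ?_
    refine ite (Primrec.eq.comp ht' (const 3)) (hb 0) ?_
    refine ite (nat_lt.comp ht' (const 7)) (Primrec.and.comp (hb 1) (hb 2)) ?_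
    exact ite (nat_lt.comp ht' (const 11)) (hb 2) (const false)
  · intro n k hk
    split_ifs at hk with h
    · simp at hk
    · have h1 : n.unpair.2 < n := by
        have := Nat.add_le_pair n.unpair.1 n.unpair.2
        rw [Nat.pair_unpair] at this
        omega
      have h2 := Nat.unpair_left_le n.unpair.2
      have h3 := Nat.unpair_right_le n.unpair.2
      simp only [List.mem_cons, List.not_mem_nil, or_false] at hk
      simp only [id]
      omega
  · intro n
    rw [Option.some_inj, Bool.eq_iff_iff, decide_eq_true_iff, mem_range_code_iff]
    split_ifs <;> simp

open Classical in
/-- Formulas, encoded by their Gödel numbers. -/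
noncomputable instance : Primcodable MLO :=
  letI := Primcodable.subtype primrecPred_mem_range_code
  Primcodable.ofEquiv (Set.range code) (Equiv.ofInjective code code_injective)

section Constructors

open Primrec

theorem primrec_code : Primrec code := Primrec.encode

theorem primrec₂_mem : Primrec₂ mem :=
  Primrec.encode_iff.1 (Primrec₂.natPair.comp (const 1) (Primrec₂.natPair.comp fst snd))

theorem primrec₂_lt : Primrec₂ lt :=
  Primrec.encode_iff.1 (Primrec₂.natPair.comp (const 2) (Primrec₂.natPair.comp fst snd))

theorem primrec_neg : Primrec neg :=
  Primrec.encode_iff.1 (Primrec₂.natPair.comp (const 3) primrec_code)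

theorem primrec₂_or : Primrec₂ or :=
  Primrec.encode_iff.1 (Primrec₂.natPair.comp (const 4)
    (Primrec₂.natPair.comp (primrec_code.comp fst) (primrec_code.comp snd)))

theorem primrec₂_and : Primrec₂ and :=
  Primrec.encode_iff.1 (Primrec₂.natPair.comp (const 5)
    (Primrec₂.natPair.comp (primrec_code.comp fst) (primrec_code.comp snd)))

theorem primrec₂_ex : Primrec₂ ex :=
  Primrec.encode_iff.1 (Primrec₂.natPair.comp (const 7)
    (Primrec₂.natPair.comp fst (primrec_code.comp snd)))

theorem primrec₂_all : Primrec₂ all :=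
  Primrec.encode_iff.1 (Primrec₂.natPair.comp (const 8)
    (Primrec₂.natPair.comp fst (primrec_code.comp snd)))

theorem primrec₂_exSet : Primrec₂ exSet :=
  Primrec.encode_iff.1 (Primrec₂.natPair.comp (const 9)
    (Primrec₂.natPair.comp fst (primrec_code.comp snd)))

theorem primrec₂_allSet : Primrec₂ allSet :=
  Primrec.encode_iff.1 (Primrec₂.natPair.comp (const 10)
    (Primrec₂.natPair.comp fst (primrec_code.comp snd)))

end Constructors
end MLO

/-! ### Primitive recursive operations on lists -/

namespace Primrec

variable {α β γ : Type*} [Primcodable α] [Primcodable β] [Primcodable γ]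

theorem list_product {f : α → List β} {g : α → List γ} (hf : Primrec f) (hg : Primrec g) :
    Primrec fun a => f a ×ˢ g a :=
  list_flatMap hf (list_map (hg.comp fst) (Primrec₂.pair.comp (snd.comp fst) snd).to₂).to₂

theorem list_sublists : Primrec (List.sublists (α := α)) := by
  refine (list_foldr (f := fun l : List α => l) (g := fun _ => [([] : List α)])
    (h := fun _ p => p.2.flatMap fun x => [x, p.1 :: x]) Primrec.id (const _) ?_).of_eq fun l => ?_
  · refine list_flatMap (snd.comp snd) ?_
    exact list_cons.comp snd (list_cons.comp
      (list_cons.comp (fst.comp (snd.comp fst)) snd) (const []))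
  · rfl

theorem list_filter {f : α → List β} {p : α → β → Prop} [∀ a, DecidablePred (p a)] (hf : Primrec f)
    (hp : PrimrecRel p) : Primrec fun a => (f a).filter fun b => p a b := by
  refine (listFilterMap hf (option_guard (p := fun (q : α × β) c => p q.1 c)
    (hp.comp (fst.comp fst) snd) snd).to₂).of_eq fun a => ?_
  rw [← List.filterMap_eq_filter]

end Primrec

namespace PrimrecPred

variable {α β : Type*} [Primcodable α] [Primcodable β]

theorem exists_mem {f : α → List β} {p : α → β → Prop} (hf : Primrec f) (hp : PrimrecRel p) :
    PrimrecPred fun a => ∃ b ∈ f a, p a b :=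
  PrimrecRel.comp (R := fun (L : List β) a => ∃ b ∈ L, p a b)
    (PrimrecRel.exists_mem_list (R := fun b a => p a b) hp.swap) hf Primrec.id

theorem forall_mem {f : α → List β} {p : α → β → Prop} (hf : Primrec f) (hp : PrimrecRel p) :
    PrimrecPred fun a => ∀ b ∈ f a, p a b :=
  PrimrecRel.comp (R := fun (L : List β) a => ∀ b ∈ L, p a b)
    (PrimrecRel.forall_mem_list (R := fun b a => p a b) hp.swap) hf Primrec.id

theorem list_mem {f : α → β} {g : α → List β} (hf : Primrec f) (hg : Primrec g) :
    PrimrecPred fun a => f a ∈ g a :=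
  (exists_mem (p := fun a b => f a = b) hg
    (Primrec.eq.comp (hf.comp Primrec.fst) Primrec.snd)).of_eq fun a => by simp

end PrimrecPred

/-! ### Computing the characteristic formulas and the sum table -/

namespace MLO

open Primrec

theorem primrec_bigAnd : Primrec bigAnd := by
  refine (list_foldr (f := fun l : List MLO => l) (g := fun _ => neg fls)
    (h := fun _ p => and p.1 p.2) Primrec.id (const _)
    (primrec₂_and.comp (fst.comp snd) (snd.comp snd)).to₂).of_eq fun l => ?_
  induction l with
  | nil => rfl
  | cons a l ih => rw [List.foldr_cons, ih, bigAnd]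

theorem primrec_bigOr : Primrec bigOr := by
  refine (list_foldr (f := fun l : List MLO => l) (g := fun _ => fls)
    (h := fun _ p => or p.1 p.2) Primrec.id (const _)
    (primrec₂_or.comp (fst.comp snd) (snd.comp snd)).to₂).of_eq fun l => ?_
  induction l with
  | nil => rfl
  | cons a l ih => rw [List.foldr_cons, ih, bigOr]

theorem primrec_signed : Primrec signed := by
  refine (list_foldr (f := fun l : List MLO => l) (g := fun _ => [([] : List MLO)])
    (h := fun _ p => p.2.map (p.1 :: ·) ++ p.2.map (neg p.1 :: ·)) Primrec.id (const _) ?_).of_eq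
    fun l => ?_
  · refine list_append.comp (list_map (snd.comp snd) ?_) (list_map (snd.comp snd) ?_)
    · exact list_cons.comp (fst.comp (snd.comp fst)) snd
    · exact list_cons.comp (primrec_neg.comp (fst.comp (snd.comp fst))) snd
  · induction l with
    | nil => rfl
    | cons a l ih => rw [List.foldr_cons, ih, signed]

variable {α : Type*} [Primcodable α]

theorem primrec_atoms {k l : α → ℕ} (hk : Primrec k) (hl : Primrec l) :
    Primrec fun a => atoms (k a) (l a) :=
  list_append.comp
    (list_map (list_product (list_range.comp hl) (list_range.comp hk))
      (primrec₂_mem.comp (fst.comp snd) (snd.comp snd)).to₂)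
    (list_map (list_product (list_range.comp hk) (list_range.comp hk))
      (primrec₂_lt.comp (fst.comp snd) (snd.comp snd)).to₂)

theorem primrec_realizes {k l : α → ℕ} {S T : α → List MLO} (hk : Primrec k) (hl : Primrec l)
    (hS : Primrec S) (hT : Primrec T) : Primrec fun a => realizes (k a) (l a) (S a) (T a) :=
  primrec₂_and.comp
    (primrec₂_and.comp
      (primrec_bigAnd.comp (list_map hS (primrec₂_ex.comp (hk.comp fst) snd)))
      (primrec₂_all.comp hk (primrec_bigOr.comp hS)))
    (primrec₂_and.comp
      (primrec_bigAnd.comp (list_map hT (primrec₂_exSet.comp (hl.comp fst) snd)))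
      (primrec₂_allSet.comp hl (primrec_bigOr.comp hT)))

/-- The recursion calls itself at other values of the parameters `k` and `l`, but always at a
smaller depth, which `Primrec.nat_omega_rec'` allows. -/
theorem primrec_hintikka : Primrec fun p : ℕ × ℕ × ℕ => hintikka p.1 p.2.1 p.2.2 := by
  have hk : Primrec fun p : ℕ × ℕ × ℕ => p.2.1 := fst.comp snd
  have hl : Primrec fun p : ℕ × ℕ × ℕ => p.2.2 := snd.comp snd
  refine nat_omega_rec' _ (m := fun p => p.1)
    (l := fun p => if p.1 = 0 then [] else
      [(p.1.pred, p.2.1 + 1, p.2.2), (p.1.pred, p.2.1, p.2.2 + 1)])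
    (g := fun p L => some <| if p.1 = 0 then (signed (atoms p.2.1 p.2.2)).map bigAnd else
      ((L.getD 0 []).sublists ×ˢ (L.getD 1 []).sublists).map
        fun q => realizes p.2.1 p.2.2 q.1 q.2) fst ?_ ?_ ?_ ?_
  · refine ite (Primrec.eq.comp fst (const 0)) (const []) ?_
    exact list_cons.comp (Primrec.pair (pred.comp fst) (Primrec.pair (succ.comp hk) hl))
      (list_cons.comp (Primrec.pair (pred.comp fst) (Primrec.pair hk (succ.comp hl))) (const []))
  · refine option_some.comp (ite (Primrec.eq.comp (fst.comp fst) (const 0)) ?_ ?_)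
    · exact list_map (primrec_signed.comp (primrec_atoms (hk.comp fst) (hl.comp fst)))
        (primrec_bigAnd.comp snd)
    · refine list_map (list_product (list_sublists.comp ((list_getD []).comp snd (const 0)))
        (list_sublists.comp ((list_getD []).comp snd (const 1)))) ?_
      exact primrec_realizes (hk.comp (fst.comp fst)) (hl.comp (fst.comp fst)) (fst.comp snd)
        (snd.comp snd)
  · rintro ⟨n, k, l⟩ q hq
    cases n with
    | zero => simp at hq
    | succ n => simp at hq; rcases hq with rfl | rfl <;> simp
  · rintro ⟨n, k, l⟩
    cases n <;> simp [hintikka]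

theorem primrec_lit {b : α → Bool} {φ : α → MLO} (hb : Primrec b) (hφ : Primrec φ) :
    Primrec fun a => lit (b a) (φ a) :=
  Primrec.cond hb hφ (primrec_neg.comp hφ)

theorem primrec_sumLits {l : α → ℕ} {σ : α → List Bool} {S S' : α → List MLO} (hl : Primrec l)
    (hσ : Primrec σ) (hS : Primrec S) (hS' : Primrec S') :
    Primrec fun a => sumLits (l a) (σ a) (S a) (S' a) := by
  have hk : Primrec fun a => List.range (σ a).length := list_range.comp (list_length.comp hσ)
  have h1 : Primrec fun q : α × ℕ × ℕ => (σ q.1).getD q.2.1 false :=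
    (list_getD false).comp (hσ.comp fst) (fst.comp snd)
  have h2 : Primrec fun q : α × ℕ × ℕ => (σ q.1).getD q.2.2 false :=
    (list_getD false).comp (hσ.comp fst) (snd.comp snd)
  have hm : Primrec fun q : α × ℕ × ℕ => mem q.2.1 q.2.2 :=
    primrec₂_mem.comp (fst.comp snd) (snd.comp snd)
  have ht : Primrec fun q : α × ℕ × ℕ => lt q.2.1 q.2.2 :=
    primrec₂_lt.comp (fst.comp snd) (snd.comp snd)
  refine list_append.comp (list_map (list_product (list_range.comp hl) hk) ?_)
    (list_map (list_product hk hk) ?_)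
  · exact primrec_lit (.cond h2 (PrimrecPred.list_mem hm (hS.comp fst)).decide
      (PrimrecPred.list_mem hm (hS'.comp fst)).decide) hm
  · exact primrec_lit (.cond h1 (.cond h2 (PrimrecPred.list_mem ht (hS.comp fst)).decide (const _))
      (.cond h2 (const _) (PrimrecPred.list_mem ht (hS'.comp fst)).decide)) ht

theorem primrec_combine {T : α → List (MLO × MLO × MLO)} {S S' H : α → List MLO} (hT : Primrec T)
    (hS : Primrec S) (hS' : Primrec S') (hH : Primrec H) :
    Primrec fun a => combine (T a) (S a) (S' a) (H a) := by
  refine list_filter (p := fun a χ => ∃ r ∈ T a, r.1 ∈ S a ∧ r.2.1 ∈ S' a ∧ r.2.2 = χ) hH ?_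
  refine PrimrecPred.exists_mem
    (p := fun (q : α × MLO) r => r.1 ∈ S q.1 ∧ r.2.1 ∈ S' q.1 ∧ r.2.2 = q.2) (hT.comp fst) ?_
  exact (PrimrecPred.list_mem (fst.comp snd) (hS.comp (fst.comp fst))).and
    ((PrimrecPred.list_mem (fst.comp (snd.comp snd)) (hS'.comp (fst.comp fst))).and
      (Primrec.eq.comp (snd.comp (snd.comp snd)) (snd.comp fst)))

theorem primrec_sumTable :
    Primrec fun p : ℕ × ℕ × List Bool => sumTable p.1 p.2.1 p.2.2 := by
  have hl : Primrec fun p : ℕ × ℕ × List Bool => p.2.1 := fst.comp snd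
  have hσ : Primrec fun p : ℕ × ℕ × List Bool => p.2.2 := snd.comp snd
  have hk : Primrec fun p : ℕ × ℕ × List Bool => p.2.2.length := list_length.comp hσ
  have hn : Primrec fun p : ℕ × ℕ × List Bool => p.1.pred := pred.comp fst
  have h1 : Primrec fun p : ℕ × ℕ × List Bool => hintikka p.1.pred (p.2.2.length + 1) p.2.1 :=
    primrec_hintikka.comp (Primrec.pair hn (Primrec.pair (succ.comp hk) hl))
  have h2 : Primrec fun p : ℕ × ℕ × List Bool => hintikka p.1.pred p.2.2.length (p.2.1 + 1) :=
    primrec_hintikka.comp (Primrec.pair hn (Primrec.pair hk (succ.comp hl)))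
  refine nat_omega_rec' _ (m := fun p => p.1)
    (l := fun p => if p.1 = 0 then [] else
      [(p.1.pred, p.2.1, p.2.2 ++ [true]), (p.1.pred, p.2.1, p.2.2 ++ [false]),
        (p.1.pred, p.2.1 + 1, p.2.2)])
    (g := fun p L => some <| if p.1 = 0 then
      (signed (atoms p.2.2.length p.2.1) ×ˢ signed (atoms p.2.2.length p.2.1)).map fun q =>
        (bigAnd q.1, bigAnd q.2, bigAnd (sumLits p.2.1 p.2.2 q.1 q.2))
      else
      (((hintikka p.1.pred (p.2.2.length + 1) p.2.1).sublists ×ˢ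
          (hintikka p.1.pred p.2.2.length (p.2.1 + 1)).sublists) ×ˢ
        ((hintikka p.1.pred (p.2.2.length + 1) p.2.1).sublists ×ˢ
          (hintikka p.1.pred p.2.2.length (p.2.1 + 1)).sublists)).map
      fun q => (realizes p.2.2.length p.2.1 q.1.1 q.1.2, realizes p.2.2.length p.2.1 q.2.1 q.2.2,
        realizes p.2.2.length p.2.1
          (combine (L.getD 0 [] ++ L.getD 1 []) q.1.1 q.2.1
            (hintikka p.1.pred (p.2.2.length + 1) p.2.1))
          (combine (L.getD 2 []) q.1.2 q.2.2 (hintikka p.1.pred p.2.2.length (p.2.1 + 1)))))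
    fst ?_ ?_ ?_ ?_
  · refine ite (Primrec.eq.comp fst (const 0)) (const []) ?_
    exact list_cons.comp (Primrec.pair hn (Primrec.pair hl (list_concat.comp hσ (const true))))
      (list_cons.comp (Primrec.pair hn (Primrec.pair hl (list_concat.comp hσ (const false))))
        (list_cons.comp (Primrec.pair hn (Primrec.pair (succ.comp hl) hσ)) (const [])))
  · refine option_some.comp (ite (Primrec.eq.comp (fst.comp fst) (const 0)) ?_ ?_)
    · have ha := primrec_signed.comp (primrec_atoms
        (hk.comp (fst (β := List (List (MLO × MLO × MLO))))) (hl.comp fst))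
      refine list_map (list_product ha ha) ?_
      exact Primrec.pair (primrec_bigAnd.comp (fst.comp snd))
        (Primrec.pair (primrec_bigAnd.comp (snd.comp snd)) (primrec_bigAnd.comp
          (primrec_sumLits (hl.comp (fst.comp fst)) (hσ.comp (fst.comp fst)) (fst.comp snd)
            (snd.comp snd))))
    · have hp := list_product
        (list_sublists.comp (h1.comp (fst (β := List (List (MLO × MLO × MLO))))))
        (list_sublists.comp (h2.comp (fst (β := List (List (MLO × MLO × MLO))))))
      refine list_map (list_product hp hp) ?_
      let Q := ((ℕ × ℕ × List Bool) × List (List (MLO × MLO × MLO))) ×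
        (List MLO × List MLO) × List MLO × List MLO
      have hk' : Primrec fun q : Q => q.1.1.2.2.length := hk.comp (fst.comp fst)
      have hl' : Primrec fun q : Q => q.1.1.2.1 := hl.comp (fst.comp fst)
      refine Primrec.pair
        (primrec_realizes hk' hl' (fst.comp (fst.comp snd)) (snd.comp (fst.comp snd)))
        (Primrec.pair (primrec_realizes hk' hl' (fst.comp (snd.comp snd)) (snd.comp (snd.comp snd)))
          (primrec_realizes hk' hl' (primrec_combine ?_ (fst.comp (fst.comp snd))
            (fst.comp (snd.comp snd)) (h1.comp (fst.comp fst)))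
            (primrec_combine ?_ (snd.comp (fst.comp snd)) (snd.comp (snd.comp snd))
              (h2.comp (fst.comp fst)))))
      · exact list_append.comp ((list_getD []).comp (snd.comp fst) (const 0))
          ((list_getD []).comp (snd.comp fst) (const 1))
      · exact (list_getD []).comp (snd.comp fst) (const 2)
  · rintro ⟨n, l, σ⟩ q hq
    cases n with
    | zero => simp at hq
    | succ n => simp at hq; rcases hq with rfl | rfl | rfl <;> simp
  · rintro ⟨n, l, σ⟩
    cases n <;> simp [sumTable]

end MLO

/-! ### Computing the game type of a sum -/

namespace MLO

/-- The set `K(C, G)`, as a list, computed by means of the sum table. The set `C` is given by a list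
of lists of codes. -/
noncomputable def kList (n : ℕ) (C : List (List ℕ)) (G : List MLO) : List MLO :=
  open Classical in
  (hintikka n 0 2).filter fun τ => ∃ c ∈ C, ∀ m ∈ c, ∃ r ∈ sumTable n 2 [],
    r.1 = τ ∧ code r.2.1 = m ∧ r.2.2 ∈ G

/-- The game type of `α + β`, as a list, computed from lists representing those of `α` and `β`. -/
noncomputable def addGameType (p : ℕ × List (List ℕ) × List (List ℕ)) : List (List ℕ) :=
  open Classical in
  ((hintikka p.1 0 2).sublists.filter fun G => ∃ c ∈ p.2.1,
    (∀ m ∈ c, m ∈ (kList p.1 p.2.2 G).map code) ∧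
      ∀ m ∈ (kList p.1 p.2.2 G).map code, m ∈ c).map (List.map code)

section Primrec

open Primrec

theorem primrec_kList {α : Type*} [Primcodable α] {n : α → ℕ} {C : α → List (List ℕ)}
    {G : α → List MLO} (hn : Primrec n) (hC : Primrec C) (hG : Primrec G) :
    Primrec fun a => kList (n a) (C a) (G a) := by
  classical
  refine list_filter (p := fun a τ => ∃ c ∈ C a, ∀ m ∈ c, ∃ r ∈ sumTable (n a) 2 [],
    r.1 = τ ∧ code r.2.1 = m ∧ r.2.2 ∈ G a)
    (primrec_hintikka.comp (.pair hn (const (0, 2)))) ?_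
  refine PrimrecPred.exists_mem (p := fun (q : α × MLO) c => ∀ m ∈ c,
    ∃ r ∈ sumTable (n q.1) 2 [], r.1 = q.2 ∧ code r.2.1 = m ∧ r.2.2 ∈ G q.1) (hC.comp fst) ?_
  refine PrimrecPred.forall_mem (p := fun (q : (α × MLO) × List ℕ) m =>
    ∃ r ∈ sumTable (n q.1.1) 2 [], r.1 = q.1.2 ∧ code r.2.1 = m ∧ r.2.2 ∈ G q.1.1) snd ?_
  refine PrimrecPred.exists_mem (p := fun (q : ((α × MLO) × List ℕ) × ℕ) r =>
    r.1 = q.1.1.2 ∧ code r.2.1 = q.2 ∧ r.2.2 ∈ G q.1.1.1)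
    (primrec_sumTable.comp (.pair (hn.comp (fst.comp (fst.comp fst))) (const (2, [])))) ?_
  exact (Primrec.eq.comp (fst.comp snd) (snd.comp (fst.comp (fst.comp fst)))).and
    ((Primrec.eq.comp (primrec_code.comp (fst.comp (snd.comp snd))) (snd.comp fst)).and
      (PrimrecPred.list_mem (snd.comp (snd.comp snd))
        (hG.comp (fst.comp (fst.comp (fst.comp fst))))))

theorem primrec_addGameType : Primrec addGameType := by
  classical
  refine list_map (list_filter (p := fun (p : ℕ × List (List ℕ) × List (List ℕ)) G => ∃ c ∈ p.2.1,
    (∀ m ∈ c, m ∈ (kList p.1 p.2.2 G).map code) ∧ ∀ m ∈ (kList p.1 p.2.2 G).map code, m ∈ c)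
    (list_sublists.comp (primrec_hintikka.comp (.pair fst (const (0, 2))))) ?_)
    (list_map snd (primrec_code.comp snd).to₂).to₂
  refine PrimrecPred.exists_mem
    (p := fun (q : (ℕ × List (List ℕ) × List (List ℕ)) × List MLO) c =>
      (∀ m ∈ c, m ∈ (kList q.1.1 q.1.2.2 q.2).map code) ∧
        ∀ m ∈ (kList q.1.1 q.1.2.2 q.2).map code, m ∈ c) (fst.comp (snd.comp fst)) ?_
  have hK : Primrec fun q : ((ℕ × List (List ℕ) × List (List ℕ)) × List MLO) × List ℕ =>
      (kList q.1.1.1 q.1.1.2.2 q.1.2).map code :=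
    list_map (primrec_kList (fst.comp (fst.comp fst)) (snd.comp (snd.comp (fst.comp fst)))
      (snd.comp fst)) (primrec_code.comp snd).to₂
  exact (PrimrecPred.forall_mem (p := fun
      (q : ((ℕ × List (List ℕ) × List (List ℕ)) × List MLO) × List ℕ) m =>
        m ∈ (kList q.1.1.1 q.1.1.2.2 q.1.2).map code) snd
        (PrimrecPred.list_mem snd (hK.comp fst))).and
    (PrimrecPred.forall_mem (p := fun
      (q : ((ℕ × List (List ℕ) × List (List ℕ)) × List MLO) × List ℕ) m => m ∈ q.2) hK
        (PrimrecPred.list_mem snd (snd.comp fst)))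

end Primrec

/-- Representation, without equality of sets of sets. -/
theorem represents_iff {L : List (List ℕ)} {C : Finset (Finset MLO)} :
    Represents L C ↔ (∀ c ∈ L, ∃ G ∈ C, G.image code = c.toFinset) ∧
      ∀ G ∈ C, ∃ c ∈ L, c.toFinset = G.image code := by
  rw [Represents, Finset.ext_iff]
  simp only [List.mem_toFinset, List.mem_map, Finset.mem_image]
  constructor
  · exact fun h => ⟨fun c hc => (h _).1 ⟨c, hc, rfl⟩, fun G hG => (h _).2 ⟨G, hG, rfl⟩⟩
  · rintro ⟨h1, h2⟩ X
    constructor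
    · rintro ⟨c, hc, rfl⟩; exact h1 c hc
    · rintro ⟨G, hG, rfl⟩; exact h2 G hG

theorem image_code_injective : Function.Injective (Finset.image code) :=
  Finset.image_injective code_injective

theorem map_code_toFinset (L : List MLO) : (L.map code).toFinset = L.toFinset.image code := by
  ext; simp

/-- The list `kList` computes `K(C, G)`, formed with respect to the sum table. -/
theorem kList_toFinset {n : ℕ} {M : List (List ℕ)} {C : Finset (Finset MLO)}
    (hM : Represents M C) (G : List MLO) :
    (kList n M G).toFinset = kRel n (fun τ τ' χ => (τ, τ', χ) ∈ sumTable n 2 []) C G.toFinset := by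
  rw [represents_iff] at hM
  -- The quantification over the codes in `c` is one over the members of `G'`.
  have key : ∀ τ (c : List ℕ) (G' : Finset MLO), G'.image code = c.toFinset →
      ((∀ m ∈ c, ∃ r ∈ sumTable n 2 [], r.1 = τ ∧ code r.2.1 = m ∧ r.2.2 ∈ G) ↔
        ∀ τ' ∈ G', ∃ χ ∈ G, (τ, τ', χ) ∈ sumTable n 2 []) := by
    intro τ c G' h
    have hc : ∀ m, m ∈ c ↔ ∃ τ' ∈ G', code τ' = m := fun m => by
      rw [← List.mem_toFinset, ← h, Finset.mem_image]
    simp only [hc, forall_exists_index, and_imp, forall_apply_eq_imp_iff₂]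
    refine forall₂_congr fun τ' _ => ⟨?_, ?_⟩
    · rintro ⟨⟨τ₁, τ₂, χ⟩, hr, rfl, h2, h3⟩
      exact ⟨χ, h3, code_injective h2 ▸ hr⟩
    · rintro ⟨χ, h3, hr⟩
      exact ⟨_, hr, rfl, rfl, h3⟩
  ext τ
  simp only [kList, List.mem_toFinset, List.mem_filter, decide_eq_true_eq, mem_kRel, Char2]
  refine and_congr_right fun _ => ⟨?_, ?_⟩
  · rintro ⟨c, hc, h⟩
    obtain ⟨G', hG', he⟩ := hM.1 c hc
    exact ⟨G', hG', (key τ c G' he).1 h⟩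
  · rintro ⟨G', hG', h⟩
    obtain ⟨c, hc, he⟩ := hM.2 G' hG'
    exact ⟨c, hc, (key τ c G' he.symm).2 h⟩

theorem represents_addGameType {n : ℕ} {α β : Ordinal.{u}} (hα : Determinate α)
    (hβ : Determinate β) {L M : List (List ℕ)} (hL : Represents L (gameType n α))
    (hM : Represents M (gameType n β)) :
    Represents (addGameType (n, L, M)) (gameType n (α + β)) := by
  -- A list of characteristic formulas is selected iff its `K`-set is in the game type of `α`.
  have key : ∀ G : List MLO, G.toFinset ⊆ Char2 n → ((∃ c ∈ L,
      (∀ m ∈ c, m ∈ (kList n M G).map code) ∧ ∀ m ∈ (kList n M G).map code, m ∈ c) ↔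
        G.toFinset ∈ gameType n (α + β)) := by
    intro G hG
    rw [mem_gameType_add_iff (isSumRel_sumTable n) hα hβ hG, ← kList_toFinset hM]
    rw [represents_iff] at hL
    have hc : ∀ c : List ℕ, ((∀ m ∈ c, m ∈ (kList n M G).map code) ∧
        ∀ m ∈ (kList n M G).map code, m ∈ c) ↔
          (kList n M G).toFinset.image code = c.toFinset := by
      intro c
      rw [← map_code_toFinset, Finset.Subset.antisymm_iff, and_comm]
      simp [Finset.subset_iff]
    simp only [hc]
    constructor
    · rintro ⟨c, hc, he⟩
      obtain ⟨G', hG', he'⟩ := hL.1 c hc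
      rwa [image_code_injective (he.trans he'.symm)]
    · intro h
      obtain ⟨c, hc, he⟩ := hL.2 _ h
      exact ⟨c, hc, he.symm⟩
  simp only [List.mem_map] at key
  rw [represents_iff]
  simp only [addGameType, List.mem_map, List.mem_filter, List.mem_sublists, decide_eq_true_eq]
  constructor
  · rintro _ ⟨G, ⟨hG, h⟩, rfl⟩
    have hGn : G.toFinset ⊆ Char2 n := fun τ hτ =>
      List.mem_toFinset.2 (hG.subset (List.mem_toFinset.1 hτ))
    exact ⟨G.toFinset, (key G hGn).1 h, (map_code_toFinset G).symm⟩
  · intro G hG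
    classical
    have hGn := (mem_gameType.1 hG).1
    have he : ((hintikka n 0 2).filter fun τ => decide (τ ∈ G)).toFinset = G := by
      ext τ
      simp only [List.mem_toFinset, List.mem_filter, decide_eq_true_eq]
      exact ⟨fun h => h.2, fun h => ⟨List.mem_toFinset.1 (hGn h), h⟩⟩
    refine ⟨_, ⟨_, ⟨List.filter_sublist, (key _ (he.symm ▸ hGn)).2 (he.symm ▸ hG)⟩, rfl⟩, ?_⟩
    rw [map_code_toFinset, he]

end MLO

theorem mainTheorem6 :
    (∀ α β : Ordinal.{u}, Determinate α → Determinate β →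
      Determinate (α + β) ∧
      ∀ n : ℕ, ∀ G : Finset MLO, G ⊆ MLO.Char2 n →
        (PlayerIWins α (MLO.disj (kUnion.{u} n (gameType n β) G)) →
          PlayerIWins (α + β) (MLO.disj G)) ∧
        (¬ PlayerIWins α (MLO.disj (kUnion.{u} n (gameType n β) G)) →
          PlayerIIWins (α + β) (MLO.disj G)) ∧
        (G ∈ gameType n (α + β) ↔ kUnion.{u} n (gameType n β) G ∈ gameType n α)) ∧
    ∃ F : ℕ × List (List ℕ) × List (List ℕ) → List (List ℕ), Computable F ∧
      ∀ (n : ℕ) (α β : Ordinal.{u}), Determinate α → Determinate β →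
        ∀ L M : List (List ℕ), Represents L (gameType n α) → Represents M (gameType n β) →
          Represents (F (n, L, M)) (gameType n (α + β)) := by
  refine ⟨fun α β hα hβ => ⟨determinate_add hα hβ, fun n G hG => ?_⟩, MLO.addGameType,
    MLO.primrec_addGameType.to_comp, fun n α β hα hβ L M => MLO.represents_addGameType hα hβ⟩
  rw [kUnion_eq_kRel]
  exact ⟨playerIWins_add (isSumRel_typeSum n) hα.1 hβ.1 hG,
    playerIIWins_add (isSumRel_typeSum n) hα hβ hG,
    mem_gameType_add_iff (isSumRel_typeSum n) hα hβ hG⟩
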